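/- Setting. Let $X$ be a finite ground set and let $f:2^X\to\mathbb{R}_{\ge 0}$ be a non-negative (possibly non-monotone) submodular function, i.e. $f(A)+f(B)\ge f(A\cup B)+f(A\cap B)$ for all $A,B\subseteq X$. Write $f(x\mid S)=f(S\cup\{x\})-f(S)$. For an integer $p\ge 1$, a $p$-matchoid is a collection of matroids $\mathcal M_\ell=(X_\ell,\mathcal I_\ell)$ with $X_\ell\subseteq X$ such that each $x\in X$ lies in at most $p$ of the sets $X_\ell$; a set $S\subseteq X$ is feasible, $S\in\mathcal I$, if $S\cap X_\ell\in\mathcal I_\ell$ for all $\ell$. Its rank $k$ is the largest size of a feasible set, and $OPT$ is a feasible set maximizing $f$. For $\bar\gamma_{\mathrm{off}}\ge 1$, let $\textsc{Offline}$ be an offline $\bar\gamma_{\mathrm{off}}$-approximation algorithm: given $B\subseteq X$ it returns a (possibly random) feasible set $S'\subseteq B$ with $f(T)\le\bar\gamma_{\mathrm{off}}\,\mathbb E[f(S')]$ for every feasible $T\subseteq B$. In each pass all elements of $X$ arrive, each exactly once, in an arbitrary order fixed in advance (possibly different in different passes). Algorithm. A current solution $S$ is kept together with the order in which its elements were added (also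 in earlier passes); for $e\in S$ let $\nu(e,S)=f(e\mid\{\text{elements of }S\text{ added before }e\})$. For $x$ with $\{x\}\in\mathcal I$, the set $C_x=C_x(S)\subseteq S$ contains, for each $\ell$ with $x\in X_\ell$ and $(S\cap X_\ell)\cup\{x\}\notin\mathcal I_\ell$, an element $t$ minimizing $\nu(t,S)$ among all $t\in S\cap X_\ell$ such that $((S\cap X_\ell)\setminus\{t\})\cup\{x\}\in\mathcal I_\ell$, and nothing else. For parameters $\alpha,\beta$, call $x$ good for $S$ if $\{x\}\in\mathcal I$ and $f(x\mid S)\ge\alpha+(1+\beta)\sum_{e\in C_x}\nu(e,S)$. Given $\varepsilon>0$, put $\varepsilon'=\min\{\varepsilon/p,1/2\}$, $d=\lceil 4/\varepsilon'\rceil$, $m=\lceil 4dk/\varepsilon'^2\rceil$, $\gamma_1=4p$, $\beta_1=1$ and, for $i>1$, $$\gamma_i=\frac{4p\,\gamma_{i-1}(\gamma_{i-1}-1)}{(\gamma_{i-1}-1+p)^2},\qquad \beta_i=\frac{\gamma_{i-1}-1-p}{\gamma_{i-1}-1+p}.$$ A first pass computes $\tau=\max\{f(\{x\}):\{x\}\in\mathcal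 I\}$ ($0$ if there is no such $x$). Then, for each $\lambda=2^j$, $j\in\mathbb Z$, with $\tau/2\le\lambda\le k\tau$ (no $\lambda$ if $\tau=0$), a copy with threshold $\alpha=\varepsilon'\lambda/(2k)$ is run; all copies run in parallel on the same $d$ further passes, with independent randomness. A copy starts with $S=S^*=\emptyset$. In its $i$-th pass it uses $\beta=\beta_i$, stores the solution $S_{\mathrm{init}}=S$ held at the start of the pass, and starts with an empty buffer $B$. When $x$ arrives, it is added to $B$ if $x\notin S_{\mathrm{init}}$ and $x$ is good for $S$. If now $|B|=m$, a uniformly random $y\in B$ is removed from $B$, $S$ is replaced by $(S\setminus C_y)\cup\{y\}$, and all elements of $B$ that are not good for the new $S$ are removed from $B$. At the end of the pass, $\textsc{Offline}(B)$ is computed, and $S^*$ is replaced by it if that does not decrease $f(S^*)$. After its $d$ passes the copy returns the better one of $S$ and $S^*$. The algorithm returns the best set $\bar S$ returned by any copy ($\emptyset$ if there are no copies). Theorem. There is an absolute constant $C>0$ such that, for all such $X$, $f$, $p$-matchoids of rank $k$, $\bar\gamma_{\mathrm{off}}$, $\textsc{Offline}$, arrival orders and all $\varepsilon>0$: for every outcome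 of the random choices, $\bar S\in\mathcal I$, the number of passes is at most $$C\cdot\max\{1,p/\varepsilon\},$$ and the total space, i.e. the sum over the copies of the largest number of elements that the copy stores at any moment (in $S_{\mathrm{init}}$, $S$, $B$, $S^*$ and the output of $\textsc{Offline}$), is at most $$C\cdot\max\{1,p/\varepsilon\}^3\,k\,(1+\log_2 k)$$ (read as $0$ if $k=0$). Moreover, $$f(OPT)\le\Bigl(p+1+\bar\gamma_{\mathrm{off}}+C\bigl(1+\bar\gamma_{\mathrm{off}}/p\bigr)\varepsilon\Bigr)\,\mathbb E[f(\bar S)].$$ In particular, for $\bar\gamma_{\mathrm{off}}=O(p)$, $\varepsilon\le p$ and $k\ge 2$, the algorithm is a $(p+1+\bar\gamma_{\mathrm{off}}+O(\varepsilon))$-approximation that uses $O(p/\varepsilon)$ passes and $O(p^3k\log k/\varepsilon^3)$ space. -/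

import Mathlib

universe u v

namespace MultipassStreaming

/-! ### Submodular functions and matchoids -/

/-- Submodularity of a set function on the subsets of a finite ground set. -/
def Submodular {X : Type u} [DecidableEq X] (f : Finset X → ℝ) : Prop :=
  ∀ A B : Finset X, f (A ∪ B) + f (A ∩ B) ≤ f A + f B

/-- A `p`-matchoid on `X`: a collection of matroids, each on some subset of `X` (its ground set
`E`), such that every element of `X` lies in the ground sets of at most `p` of them. -/
structure Matchoid (ι : Type v) (X : Type u) (p : ℕ) where
  matroid : ι → Matroid X
  degree_le : ∀ x : X, {l : ι | x ∈ (matroid l).E}.encard ≤ p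

namespace Matchoid

variable {ι : Type v} {X : Type u} {p : ℕ}

/-- `S` is independent (feasible) if `S ∩ X_l` is independent in the `l`-th matroid, for all `l`. -/
def Indep (M : Matchoid ι X p) (S : Finset X) : Prop :=
  ∀ l, (M.matroid l).Indep (↑S ∩ (M.matroid l).E)

open scoped Classical in
/-- The rank of a matchoid: the largest size of an independent set. -/
noncomputable def rank [Fintype X] (M : Matchoid ι X p) : ℕ :=
  (Finset.univ.filter fun S : Finset X => M.Indep S).sup Finset.card

/-- `O` is an optimal solution of the problem of maximizing `f` over the independent sets. -/
def IsOptimal (M : Matchoid ι X p) (f : Finset X → ℝ) (O : Finset X) : Prop :=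
  M.Indep O ∧ ∀ T, M.Indep T → f T ≤ f O

end Matchoid

/-- Expected value of `f S` for a random set `S` with law `μ`. -/
noncomputable def expect {X : Type u} [Fintype X] (μ : PMF (Finset X)) (f : Finset X → ℝ) : ℝ :=
  ∑ S : Finset X, (μ S).toReal * f S

/-- `offline` is a (possibly randomized) offline approximation algorithm with factor `γ` for
maximizing `f` under the constraint `M`: given a set `B` of elements, it returns an independent
subset of `B` whose expected value is at least `1 / γ` times that of any independent subset
of `B`. -/
def IsOfflineApprox {ι : Type v} {X : Type u} [Fintype X] {p : ℕ} (M : Matchoid ι X p)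
    (f : Finset X → ℝ) (γ : ℝ) (offline : Finset X → PMF (Finset X)) : Prop :=
  ∀ B : Finset X,
    (∀ S ∈ (offline B).support, S ⊆ B ∧ M.Indep S) ∧
    ∀ T ⊆ B, M.Indep T → f T ≤ γ * expect (offline B) f

/-! ### Incremental values and the procedure `Exchange`

A current solution is kept as a list whose order is the (pretend) order of arrival: the elements
of the solution at the start of the pass come first, in the order inherited from the preceding
pass, and then the elements added during the pass, in the order in which they were added. -/

section Exchange

variable {ι : Type v} {X : Type u} [DecidableEq X] {p : ℕ}

/-- The marginal value `f(x | S) = f(S + x) - f(S)`. -/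
def marginal (f : Finset X → ℝ) (x : X) (S : Finset X) : ℝ :=
  f (insert x S) - f S

/-- The incremental value `ν(e, S)`: the marginal value of `e` with respect to the elements of `S`
that precede `e`. -/
def incr (f : Finset X → ℝ) (S : List X) (e : X) : ℝ :=
  marginal f e (S.takeWhile fun t => t ≠ e).toFinset

open scoped Classical in
/-- The elements `y ∈ S_l = S ∩ X_l` for which `S_l - y + x` is independent in the `l`-th
matroid. -/
noncomputable def swaps (M : Matchoid ι X p) (x : X) (S : List X) (l : ι) : List X :=
  S.filter fun y => y ∈ (M.matroid l).E ∧
    (M.matroid l).Indep (insert x (({z | z ∈ S} ∩ (M.matroid l).E) \ {y}))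

open scoped Classical in
/-- The set `C_x` returned by `Exchange(x, S)`: for every matroid with `x ∈ X_l` and `S_l + x`
dependent, it contains one element of minimum incremental value among the `swaps`. -/
noncomputable def exchange (M : Matchoid ι X p) (f : Finset X → ℝ) (x : X) (S : List X) :
    Finset X :=
  S.toFinset.filter fun y => ∃ l, x ∈ (M.matroid l).E ∧
    ¬ (M.matroid l).Indep (insert x ({z | z ∈ S} ∩ (M.matroid l).E)) ∧
    (swaps M x S l).argmin (incr f S) = some y

/-- The test deciding whether `x` is a good element with respect to the current solution `S`.
Elements that are not feasible on their own never pass. -/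
def Good (M : Matchoid ι X p) (f : Finset X → ℝ) (α β : ℝ) (S : List X) (x : X) : Prop :=
  M.Indep {x} ∧
    α + (1 + β) * ∑ e ∈ exchange M f x S, incr f S e ≤ marginal f x S.toFinset

end Exchange

/-! ### One copy of the randomized local search -/

/-- The memory of one copy of the randomized local search, run with a guess of the optimal
value. -/
structure Copy (X : Type u) where
  /-- the guess of the optimal value -/
  guess : ℝ
  /-- the solution `S_init` at the start of the current pass -/
  start : List X
  /-- the current solution `S` -/
  cur : List X
  /-- the buffer `B` -/
  buf : Finset X
  /-- the best offline solution `S'` found so far -/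
  best : Finset X
  /-- bookkeeping: the largest number of elements held in memory at any moment so far -/
  peak : ℕ

namespace Copy

variable {ι : Type v} {X : Type u} [DecidableEq X] {p : ℕ}

/-- The number of elements held in memory. -/
def size (c : Copy X) : ℕ :=
  c.start.length + c.cur.length + c.buf.card + c.best.card

/-- Record the memory in use, when `extra` further elements are held besides the fields of `c`. -/
def tick (c : Copy X) (extra : ℕ) : Copy X :=
  { c with peak := max c.peak (c.size + extra) }

/-- The memory before the first pass: all sets are empty. -/
def fresh (guess : ℝ) : Copy X :=
  { guess := guess, start := [], cur := [], buf := ∅, best := ∅, peak := 0 }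

/-- Start of a pass: `S_init` is the current solution and the buffer is empty. -/
def startPass (c : Copy X) : Copy X :=
  tick { c with start := c.cur, buf := ∅ } 0

open scoped Classical in
/-- Arrival of `x`. If `x` is not in `S_init` and is good, it joins the buffer. If the buffer then
has `m` elements, a uniformly random element `y` of it is moved to the current solution, in
exchange for `C_y`, and the elements of the buffer that are no longer good are removed. -/
noncomputable def arrive (M : Matchoid ι X p) (f : Finset X → ℝ) (α β : ℝ) (m : ℕ) (x : X)
    (c : Copy X) : PMF (Copy X) :=
  let c₁ : Copy X :=
    tick { c with
      buf := if x ∉ c.start ∧ Good M f α β c.cur x then insert x c.buf else c.buf } 0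
  if h : c₁.buf.Nonempty ∧ c₁.buf.card = m then
    (PMF.uniformOfFinset c₁.buf h.1).map fun y =>
      let S : List X := (c₁.cur.filter fun z => z ∉ exchange M f y c₁.cur) ++ [y]
      tick { c₁ with
        cur := S
        buf := (c₁.buf.erase y).filter fun z => Good M f α β S z } 0
  else PMF.pure c₁

open scoped Classical in
/-- End of a pass: the offline algorithm is applied to the buffer, and the better one of its
output and the best earlier offline solution is kept. -/
noncomputable def finishPass (f : Finset X → ℝ) (offline : Finset X → PMF (Finset X))
    (c : Copy X) : PMF (Copy X) :=
  (offline c.buf).map fun S' =>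
    { tick c S'.card with best := if f c.best ≤ f S' then S' else c.best }

open scoped Classical in
/-- The solution returned by the copy: the better one of `S` and `S'`. -/
noncomputable def result (f : Finset X → ℝ) (c : Copy X) : Finset X :=
  if f c.cur.toFinset ≤ f c.best then c.best else c.cur.toFinset

end Copy

/-! ### The parameters -/

/-- The internal accuracy `ε' = ε / p`, capped at `1 / 2`. -/
noncomputable def accuracy (p : ℕ) (ε : ℝ) : ℝ :=
  min (ε / p) (1 / 2)

/-- The number `d` of local search passes. -/
noncomputable def numPasses (ε' : ℝ) : ℕ :=
  ⌈4 / ε'⌉₊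

/-- The size `m` of the buffer. -/
noncomputable def bufferSize (k : ℕ) (ε' : ℝ) : ℕ :=
  ⌈4 * (numPasses ε' : ℝ) * k / ε' ^ 2⌉₊

/-- The additive threshold `α`, for the guess `g` of the optimal value. -/
noncomputable def threshold (k : ℕ) (ε' g : ℝ) : ℝ :=
  ε' * g / (2 * k)

/-- The guarantees `γ_1, γ_2, …` (with indices shifted to start at `0`). -/
noncomputable def gammaSeq (p : ℕ) : ℕ → ℝ
  | 0 => 4 * p
  | i + 1 => 4 * p * (gammaSeq p i * (gammaSeq p i - 1)) / (gammaSeq p i - 1 + p) ^ 2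

/-- The parameters `β_1, β_2, …` (with indices shifted to start at `0`). -/
noncomputable def betaSeq (p : ℕ) : ℕ → ℝ
  | 0 => 1
  | i + 1 => (gammaSeq p i - 1 - p) / (gammaSeq p i - 1 + p)

/-- The exponents of the guesses of the optimal value: all integers `i` with
`τ / 2 ≤ 2 ^ i ≤ k τ` (none if `τ = 0`). -/
noncomputable def guesses (τ : ℝ) (k : ℕ) : Finset ℤ :=
  if 0 < τ then Finset.Icc (Int.clog 2 (τ / 2)) (Int.log 2 (k * τ)) else ∅

theorem mem_guesses {τ : ℝ} {k : ℕ} (hτ : 0 < τ) (hk : 0 < k) (i : ℤ) :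
    i ∈ guesses τ k ↔ τ / 2 ≤ (2 : ℝ) ^ i ∧ (2 : ℝ) ^ i ≤ k * τ := by
  have hk' : (0 : ℝ) < k := by exact_mod_cast hk
  have h1 := Int.le_zpow_iff_clog_le (b := 2) (by norm_num) (x := i) (half_pos hτ)
  have h2 := Int.zpow_le_iff_le_log (b := 2) (by norm_num) (x := i) (mul_pos hk' hτ)
  rw [guesses, if_pos hτ, Finset.mem_Icc]
  push_cast at h1 h2
  rw [h1, h2]

/-! ### The multi-pass algorithm -/

/-- The state of the whole algorithm: the parallel copies, and the number of passes over the
stream made so far. -/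
structure Run (X : Type u) where
  copies : List (Copy X)
  passes : ℕ

section Multipass

variable {ι : Type v} {X : Type u} [Fintype X] [DecidableEq X] {p : ℕ}

open scoped Classical in
/-- The number `τ`, computed in one pass over the stream: the largest value of a feasible
singleton (`0` if there is none). -/
noncomputable def maxSingleton (M : Matchoid ι X p) (f : Finset X → ℝ) (stream : List X) : ℝ :=
  stream.foldl (fun t x => if M.Indep {x} then max t (f {x}) else t) 0

/-- The first pass computes `τ`; afterwards one copy is set up for each guess. -/
noncomputable def firstPass (M : Matchoid ι X p) (f : Finset X → ℝ) (stream : List X) : Run X :=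
  { copies := (guesses (maxSingleton M f stream) M.rank).toList.map fun i =>
      Copy.fresh ((2 : ℝ) ^ i)
    passes := 1 }

/-- One pass of the randomized local search with parameter `β`, made by all the copies in
parallel, each with its own independent random choices. -/
noncomputable def localSearchPass (M : Matchoid ι X p) (f : Finset X → ℝ)
    (offline : Finset X → PMF (Finset X)) (ε' β : ℝ) (stream : List X) (R : Run X) :
    PMF (Run X) :=
  (stream.foldlM
    (fun (cs : List (Copy X)) (x : X) =>
      cs.mapM fun c =>
        Copy.arrive M f (threshold M.rank ε' c.guess) β (bufferSize M.rank ε') x c)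
    (R.copies.map Copy.startPass)).bind fun cs =>
  (cs.mapM (Copy.finishPass f offline)).map fun cs' =>
    { copies := cs', passes := R.passes + 1 }

/-- The law of the state after the first pass and `i` local search passes. In its `j`-th pass
(`j = 0, 1, …`) the algorithm reads the elements in the order `stream j`. -/
noncomputable def runPasses (M : Matchoid ι X p) (f : Finset X → ℝ)
    (offline : Finset X → PMF (Finset X)) (ε' : ℝ) (stream : ℕ → List X) : ℕ → PMF (Run X)
  | 0 => PMF.pure (firstPass M f (stream 0))
  | i + 1 => (runPasses M f offline ε' stream i).bind
      (localSearchPass M f offline ε' (betaSeq p i) (stream (i + 1)))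

/-- The randomized multi-pass streaming local search with accuracy parameter `ε`: the law of its
final state. -/
noncomputable def multipassRandomizedLocalSearch (M : Matchoid ι X p) (f : Finset X → ℝ)
    (offline : Finset X → PMF (Finset X)) (ε : ℝ) (stream : ℕ → List X) : PMF (Run X) :=
  runPasses M f offline (accuracy p ε) stream (numPasses (accuracy p ε))

/-- The solution returned: the best one of the solutions of all the copies (`∅` if there are no
copies). -/
noncomputable def Run.output (f : Finset X → ℝ) (R : Run X) : Finset X :=
  ((R.copies.map (Copy.result f)).argmax f).getD ∅

/-- The total space: the sum over the copies of the largest number of elements that the copy held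
in memory at any moment. -/
def Run.space (R : Run X) : ℕ :=
  (R.copies.map Copy.peak).sum

end Multipass

/-- Every element of the ground set arrives exactly once. -/
def IsArrivalOrder {X : Type u} (s : List X) : Prop :=
  s.Nodup ∧ ∀ x : X, x ∈ s

end MultipassStreaming

open MultipassStreaming

/-! Write O for the optimal set and A for the set of elements that have been in the solution. The
proof separates two questions: how well a pass competes with f(O ∪ A), and how far f(O ∪ A) can fall
below f(O) when f is not monotone.

One pass (`PassHistory.optimal_le`). A feasible element outside A ∪ B failed the test, on arrival or
when the buffer was cleaned, so its marginal value is at most α plus (1 + β) times a sum of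
increments, one for each matroid in which it conflicts with S. For the l-th matroid let Z_l be the
elements of A ∩ X_l not evicted on its account. An evicted element is spanned by the newcomer and
solution elements that weigh at least as much, so spans of superlevel sets of Z_l never shrink.
Rejected elements of O thus stay spanned by elements at least as heavy as their charge, and
comparing ranks bounds the charges in l by the weight of Z_l. An element of S lies in at most p of
the Z_l and an evicted one in at most p - 1, while the factor β in the test bounds the evicted
weight by (f(S) - f(S₀)) / β. The part O ∩ B is left to the offline algorithm, at the price γ.

Recursion (`le_gammaSeq_mul`). The pass inequality has a multiple of f(S₀) on its smaller side, so a
good solution from the preceding pass improves the next ratio. The β_i minimise the resulting ratio,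
and the excess of γ_i over p + 1 decays like 4p / i; hence 4 / ε' passes leave at most pε'.

Non-monotonicity (`potential_le_mean_arrive`). The smallest value of f between O and O ∪ A is a
non-negative submodular function of A, so inserting a uniformly random one of m candidates loses in
expectation at most a fraction 1 / m of it. The number of exchanges is random, but each raises f(S)
by at least α, and f(S) ≤ f(O). Multiplying by 1 - (f(O) - f(S)) / (αm), which grows by at least 1 /
m per exchange, gives a quantity that does not decrease in expectation over all passes. It starts at
no less than (1 - f(O) / (αm)) f(O).

Assembly. Some guess is within a factor two of f(O), and for it both kα and f(O)² / (αm) are at most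
ε' f(O) / 2. The marginal law of its copy in the parallel run is that of the copy alone
(`map_runPasses`). If f(O) ≤ f(∅), the bound holds because no copy ever falls below f(∅). -/

namespace MultipassStreaming

/-! ### Submodular functions and the lower hull -/

section Submodular

variable {X : Type u} [DecidableEq X] {f : Finset X → ℝ}

/-- The condition x ∉ T cannot be dropped: for x ∈ T the left side is 0, while the marginal value
over S may be negative. -/
theorem Submodular.marginal_anti (hf : Submodular f) {S T : Finset X} (h : S ⊆ T) {x : X}
    (hx : x ∉ T) : marginal f x T ≤ marginal f x S := by
  have h1 := hf (insert x S) T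
  have h2 : insert x S ∪ T = insert x T := by
    ext z; simp only [Finset.mem_union, Finset.mem_insert]
    constructor
    · rintro ((h' | h') | h')
      exacts [Or.inl h', Or.inr (h h'), Or.inr h']
    · rintro (h' | h')
      exacts [Or.inl (Or.inl h'), Or.inr h']
  have h3 : insert x S ∩ T = S := by
    rw [Finset.insert_inter_of_notMem hx, Finset.inter_eq_left.2 h]
  rw [h2, h3] at h1
  unfold marginal
  linarith

theorem Submodular.union_le_sum_marginal (hf : Submodular f) (A R : Finset X)
    (hR : Disjoint R A) : f (A ∪ R) ≤ f A + ∑ x ∈ R, marginal f x A := by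
  induction R using Finset.induction_on with
  | empty => simp
  | insert x R hx ih =>
    rw [Finset.sum_insert hx, Finset.union_insert]
    rw [Finset.disjoint_insert_left] at hR
    have h := hf.marginal_anti (S := A) (T := A ∪ R) Finset.subset_union_left (x := x)
      (by simp [hx, hR.1])
    have h' := ih hR.2
    unfold marginal at h h' ⊢
    linarith

/-- The sum of the increments obtained by adding the elements of `B` one at a time. -/
theorem Submodular.sum_insert_ge (hf : Submodular f) (h0 : ∀ S, 0 ≤ f S) (A B : Finset X) :
    ((B.card : ℝ) - 1) * f A ≤ ∑ y ∈ B, f (insert y A) := by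
  have key : f (A ∪ B) - f A ≤ ∑ y ∈ B, (f (insert y A) - f A) := by
    have h := hf.union_le_sum_marginal A (B \ A) Finset.sdiff_disjoint
    rw [Finset.union_sdiff_self_eq_union] at h
    -- B may meet A: in the application A collects earlier passes as well, and a buffered element
    -- may have been in the solution then. Such elements contribute zero.
    have h2 : ∑ y ∈ B \ A, marginal f y A = ∑ y ∈ B, (f (insert y A) - f A) := by
      refine Finset.sum_subset Finset.sdiff_subset fun x hx hx' => ?_
      have : x ∈ A := by
        by_contra hc
        exact hx' (Finset.mem_sdiff.2 ⟨hx, hc⟩)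
      rw [marginal, Finset.insert_eq_of_mem this, sub_self]
    linarith
  rw [Finset.sum_sub_distrib, Finset.sum_const, nsmul_eq_mul] at key
  have := h0 (A ∪ B)
  linarith

/-- The smallest value of `f` on the sets between `O` and `O ∪ A`. -/
noncomputable def lowerHull (f : Finset X → ℝ) (O A : Finset X) : ℝ :=
  A.powerset.inf' ⟨∅, Finset.empty_mem_powerset A⟩ fun B => f (O ∪ B)

theorem lowerHull_le (f : Finset X → ℝ) (O : Finset X) {A B : Finset X} (h : B ⊆ A) :
    lowerHull f O A ≤ f (O ∪ B) :=
  Finset.inf'_le _ (Finset.mem_powerset.2 h)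

theorem exists_lowerHull_eq (f : Finset X → ℝ) (O A : Finset X) :
    ∃ B ⊆ A, lowerHull f O A = f (O ∪ B) := by
  obtain ⟨B, hB, h⟩ := Finset.exists_mem_eq_inf' ⟨∅, Finset.empty_mem_powerset A⟩
    fun B => f (O ∪ B)
  exact ⟨B, Finset.mem_powerset.1 hB, h⟩

theorem lowerHull_empty (f : Finset X → ℝ) (O : Finset X) : lowerHull f O ∅ = f O := by
  obtain ⟨B, hB, h⟩ := exists_lowerHull_eq f O ∅
  rw [h, Finset.subset_empty.1 hB, Finset.union_empty]

theorem lowerHull_nonneg (h0 : ∀ S, 0 ≤ f S) (O A : Finset X) : 0 ≤ lowerHull f O A := by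
  obtain ⟨B, -, h⟩ := exists_lowerHull_eq f O A
  exact h ▸ h0 _

/-- The union and the intersection of two minimisers are candidates for A₁ ∪ A₂ and A₁ ∩ A₂. Unlike
f(O ∪ A), the hull can only fall as A grows, so its value at the set accumulated over all passes
bounds f(O ∪ A) for the set A of any single pass. -/
theorem Submodular.lowerHull (hf : Submodular f) (O : Finset X) :
    Submodular (lowerHull f O) := by
  intro A₁ A₂
  obtain ⟨B₁, h₁, e₁⟩ := exists_lowerHull_eq f O A₁
  obtain ⟨B₂, h₂, e₂⟩ := exists_lowerHull_eq f O A₂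
  rw [e₁, e₂]
  have h := hf (O ∪ B₁) (O ∪ B₂)
  have u : O ∪ B₁ ∪ (O ∪ B₂) = O ∪ (B₁ ∪ B₂) := by
    rw [Finset.union_union_union_comm, Finset.union_self]
  rw [u, ← Finset.union_inter_distrib_left] at h
  have a := lowerHull_le f O (Finset.union_subset_union h₁ h₂)
  have b := lowerHull_le f O (Finset.inter_subset_inter h₁ h₂)
  linarith

end Submodular

/-! ### Incremental values along an ordered solution -/

section Lists

variable {X : Type u} [DecidableEq X] {f : Finset X → ℝ}

theorem notMem_takeWhile_ne (S : List X) (e : X) : e ∉ S.takeWhile fun t => t ≠ e := by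
  intro h
  simpa using List.mem_takeWhile_imp h

theorem takeWhile_filter_subset (S : List X) (q : X → Bool) (y e : X) (he : e ∈ S)
    (hq : q e = true) :
    ((S.filter q ++ [y]).takeWhile fun t => t ≠ e) ⊆ S.takeWhile fun t => t ≠ e := by
  induction S with
  | nil => simp at he
  | cons a S ih =>
    by_cases hae : a = e
    · subst hae
      simp [hq]
    · have he' : e ∈ S := by
        rcases List.mem_cons.1 he with h | h
        exacts [absurd h.symm hae, h]
      have := ih he'
      by_cases hqa : q a = true
      · rw [List.filter_cons_of_pos hqa, List.cons_append, List.takeWhile_cons_of_pos (by simpa),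
          List.takeWhile_cons_of_pos (by simpa)]
        exact List.cons_subset_cons a this
      · rw [List.filter_cons_of_neg hqa, List.takeWhile_cons_of_pos (by simpa)]
        exact fun z hz => List.mem_cons_of_mem _ (this hz)

/-- Filtering thins out the elements before e, and y is appended after e, so the marginal value of e
is taken over a smaller set. Increments of surviving elements therefore never fall. -/
theorem Submodular.incr_le_incr_filter (hf : Submodular f) (S : List X) (q : X → Bool) (y e : X)
    (he : e ∈ S) (hq : q e = true) : incr f S e ≤ incr f (S.filter q ++ [y]) e := by
  refine hf.marginal_anti (fun z hz => ?_) (by simpa using notMem_takeWhile_ne S e)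
  rw [List.mem_toFinset] at hz ⊢
  exact takeWhile_filter_subset S q y e he hq hz

theorem takeWhile_append_singleton (S : List X) {y : X} (hy : y ∉ S) :
    ((S ++ [y]).takeWhile fun t => t ≠ y) = S := by
  rw [List.takeWhile_append_of_pos]
  · simp
  · intro z hz
    simp only [ne_eq, decide_not, Bool.not_eq_eq_eq_not, Bool.not_true, decide_eq_false_iff_not]
    rintro rfl
    exact hy hz

theorem incr_append_self (S : List X) {y : X} (hy : y ∉ S) :
    incr f (S ++ [y]) y = marginal f y S.toFinset := by
  rw [incr, takeWhile_append_singleton S hy]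

theorem incr_append_of_mem (S : List X) {y e : X} (he : e ∈ S) :
    incr f (S ++ [y]) e = incr f S e := by
  have : ((S ++ [y]).takeWhile fun t => t ≠ e) = S.takeWhile fun t => t ≠ e := by
    rw [List.takeWhile_append, if_neg]
    intro h
    have h2 := (List.takeWhile_prefix (l := S) fun t => decide (t ≠ e)).eq_of_length h
    exact notMem_takeWhile_ne S e (by rw [h2]; exact he)
  rw [incr, incr, this]

theorem sum_incr (S : List X) (hS : S.Nodup) :
    ∑ e ∈ S.toFinset, incr f S e = f S.toFinset - f ∅ := by
  induction S using List.reverseRecOn with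
  | nil => simp
  | append_singleton S y ih =>
    have hy : y ∉ S := by
      intro h
      exact (List.nodup_append.1 hS).2.2 y h y (by simp) rfl
    have hS' : S.Nodup := (List.nodup_append.1 hS).1
    have e1 : (S ++ [y]).toFinset = insert y S.toFinset := by
      ext z; simp
    rw [e1, Finset.sum_insert (by simpa using hy), incr_append_self S hy,
      Finset.sum_congr rfl fun e he => incr_append_of_mem S (List.mem_toFinset.1 he), ih hS',
      marginal]
    ring

/-- Induction along the order: a dropped element costs exactly its increment, and a kept element
gains at least as much over the thinned prefix as over the full one. -/
theorem Submodular.sub_filter_le (hf : Submodular f) (S : List X) (hS : S.Nodup) (q : X → Bool) :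
    f S.toFinset - f (S.filter q).toFinset ≤
      ∑ e ∈ S.toFinset.filter (fun e => q e = false), incr f S e := by
  induction S using List.reverseRecOn with
  | nil => simp
  | append_singleton S y ih =>
    have hy : y ∉ S := by
      intro h
      exact (List.nodup_append.1 hS).2.2 y h y (by simp) rfl
    have hS' : S.Nodup := (List.nodup_append.1 hS).1
    have e1 : (S ++ [y]).toFinset = insert y S.toFinset := by
      ext z; simp
    have hsum : ∑ e ∈ S.toFinset.filter (fun e => q e = false), incr f (S ++ [y]) e =
        ∑ e ∈ S.toFinset.filter (fun e => q e = false), incr f S e :=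
      Finset.sum_congr rfl fun e he =>
        incr_append_of_mem S (List.mem_toFinset.1 (Finset.mem_filter.1 he).1)
    have hsub : (S.filter q).toFinset ⊆ S.toFinset := fun z hz => by
      rw [List.mem_toFinset] at hz ⊢
      exact List.mem_of_mem_filter hz
    have ih' := ih hS'
    by_cases hq : q y = true
    · have e2 : ((S ++ [y]).filter q).toFinset = insert y (S.filter q).toFinset := by
        rw [List.filter_append]; ext z; simp [hq]
      rw [e2, e1, Finset.filter_insert, if_neg (by simp [hq]), hsum]
      have := hf.marginal_anti hsub (x := y) (by simpa using hy)
      unfold marginal at this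
      linarith
    · have hq' : q y = false := by simpa using hq
      have e2 : ((S ++ [y]).filter q).toFinset = (S.filter q).toFinset := by
        rw [List.filter_append]; ext z; simp [hq']
      rw [e2, e1, Finset.filter_insert, if_pos hq', Finset.sum_insert (by simp [hy]), hsum,
        incr_append_self S hy, marginal]
      linarith

end Lists

/-- Comparison of two sums of non-negative reals through their distribution functions. -/
theorem sum_le_sum_of_card_superlevel {α β : Type*} (R : Finset α) (Z : Finset β) (a : α → ℝ)
    (b : β → ℝ) (hb : ∀ z ∈ Z, 0 ≤ b z)
    (h : ∀ θ : ℝ, 0 < θ → (R.filter fun x => θ ≤ a x).card ≤ (Z.filter fun z => θ ≤ b z).card) :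
    ∑ x ∈ R, a x ≤ ∑ z ∈ Z, b z := by
  classical
  induction hn : R.card generalizing R Z with
  | zero =>
    rw [Finset.card_eq_zero.1 hn, Finset.sum_empty]
    exact Finset.sum_nonneg hb
  | succ n ih =>
    have hne : R.Nonempty := Finset.card_pos.1 (by omega)
    obtain ⟨x, hx, hmax⟩ := R.exists_max_image a hne
    by_cases hpos : 0 < a x
    · have h1 := h (a x) hpos
      have h2 : 0 < (R.filter fun y => a x ≤ a y).card :=
        Finset.card_pos.2 ⟨x, Finset.mem_filter.2 ⟨hx, le_rfl⟩⟩
      obtain ⟨z, hz⟩ := Finset.card_pos.1 (h2.trans_le h1)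
      obtain ⟨hzZ, hz⟩ := Finset.mem_filter.1 hz
      -- Match the largest element x of R with some z of at least its value. Up to the level `a x`
      -- both superlevel counts drop by one; above it the count for R is zero.
      have key := ih (R.erase x) (Z.erase z) (fun w hw => hb w (Finset.mem_of_mem_erase hw))
        (fun θ hθ => by
          rw [Finset.filter_erase, Finset.filter_erase]
          by_cases hθx : θ ≤ a x
          · rw [Finset.card_erase_of_mem (Finset.mem_filter.2 ⟨hx, hθx⟩),
              Finset.card_erase_of_mem (Finset.mem_filter.2 ⟨hzZ, hθx.trans hz⟩)]
            exact Nat.sub_le_sub_right (h θ hθ) 1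
          · have : (R.filter fun y => θ ≤ a y) = ∅ :=
              Finset.filter_eq_empty_iff.2 fun y hy hy' => hθx (hy'.trans (hmax y hy))
            rw [this]
            simp)
        (by rw [Finset.card_erase_of_mem hx]; omega)
      rw [← Finset.add_sum_erase _ _ hx, ← Finset.add_sum_erase _ _ hzZ]
      linarith
    · exact (Finset.sum_nonpos fun y hy => (hmax y hy).trans (not_lt.1 hpos)).trans
        (Finset.sum_nonneg hb)

/-! ### Matroid exchange -/

section Indep

variable {ι : Type v} {X : Type u} {p : ℕ}

theorem Matchoid.Indep.mono {M : Matchoid ι X p} {S T : Finset X} (hT : M.Indep T) (h : S ⊆ T) :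
    M.Indep S := fun l =>
  (hT l).subset (Set.inter_subset_inter_left _ (Finset.coe_subset.2 h))

theorem Matchoid.indep_empty (M : Matchoid ι X p) : M.Indep ∅ := fun l => by simp

end Indep

section Exchange

variable {ι : Type v} {X : Type u} [DecidableEq X] {p : ℕ}

theorem coe_toFinset_eq (S : List X) : (↑S.toFinset : Set X) = {z | z ∈ S} := by
  ext z; simp

/-- What the element chosen by `Exchange` in a single matroid provides. -/
theorem exists_argmin_swaps {M : Matchoid ι X p} {S : List X} (ν : X → ℝ) {x : X} {l : ι}
    (hS : M.Indep S.toFinset) (hx : M.Indep {x}) (hxE : x ∈ (M.matroid l).E)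
    (hdep : ¬ (M.matroid l).Indep (insert x ({z | z ∈ S} ∩ (M.matroid l).E))) :
    ∃ c, (swaps M x S l).argmin ν = some c ∧ c ∈ S ∧ c ∈ (M.matroid l).E ∧ x ≠ c ∧
      (M.matroid l).Indep (insert x (({z | z ∈ S} ∩ (M.matroid l).E) \ {c})) ∧
      x ∈ (M.matroid l).closure {e | e ∈ S ∧ e ∈ (M.matroid l).E ∧ ν c ≤ ν e} ∧
      c ∈ (M.matroid l).closure
        (insert x {e | e ∈ S ∧ e ∈ (M.matroid l).E ∧ e ≠ c ∧ ν c ≤ ν e}) := by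
  set N := M.matroid l with hN
  set I : Set X := {z | z ∈ S} ∩ N.E with hI
  have hIi : N.Indep I := by
    have := hS l
    rwa [coe_toFinset_eq] at this
  have hxI : x ∉ I := fun h => hdep (by rwa [Set.insert_eq_of_mem h])
  have hcl : x ∈ N.closure I := by
    by_contra h
    exact hdep ((hIi.insert_indep_iff_of_notMem hxI).2 ⟨hxE, h⟩)
  have hcirc := hIi.fundCircuit_isCircuit hcl hxI
  set K := N.fundCircuit x I with hK
  have hxK : x ∈ K := N.mem_fundCircuit x I
  have hKI : ∀ e ∈ K, e ≠ x → e ∈ I := fun e he hne =>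
    (N.fundCircuit_subset_insert x I he).resolve_left hne
  have hswap : ∀ e ∈ K, e ≠ x → e ∈ swaps M x S l := fun e he hne => by
    have h1 := (hIi.mem_fundCircuit_iff hcl hxI).1 he
    have h2 := hKI e he hne
    simp only [swaps, List.mem_filter, decide_eq_true_eq]
    refine ⟨h2.1, h2.2, ?_⟩
    rwa [← Set.insert_sdiff_of_notMem _ (by simpa using hne.symm)]
  -- Without swaps the circuit would be the loop {x}, but {x} is feasible.
  have hne : swaps M x S l ≠ [] := by
    intro hnil
    have : K = {x} := by
      refine Set.Subset.antisymm (fun e he => ?_) (by simpa using hxK)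
      by_contra hc
      have := hswap e he (by simpa using hc)
      rw [hnil] at this
      simp at this
    refine hcirc.not_indep ?_
    rw [this]
    have := hx l
    rwa [Finset.coe_singleton, Set.inter_eq_left.2 (by simpa using hxE)] at this
  obtain ⟨c, hc⟩ : ∃ c, (swaps M x S l).argmin ν = some c := by
    rcases h : (swaps M x S l).argmin ν with _ | c
    · exact absurd (List.argmin_eq_none.1 h) hne
    · exact ⟨c, rfl⟩
  have hcm : c ∈ swaps M x S l := List.argmin_mem hc
  have hmin : ∀ e ∈ swaps M x S l, ν c ≤ ν e := fun e he => List.le_of_mem_argmin he hc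
  simp only [swaps, List.mem_filter, decide_eq_true_eq] at hcm
  obtain ⟨hcS, hcE, hcI⟩ := hcm
  have hxc : x ≠ c := fun h => hxI ⟨by rw [h]; exact hcS, by rw [h]; exact hcE⟩
  have hcK : c ∈ K := by
    rw [hK, hIi.mem_fundCircuit_iff hcl hxI, Set.insert_sdiff_of_notMem _ (by simpa using hxc)]
    exact hcI
  refine ⟨c, hc, hcS, hcE, hxc, hcI, ?_, ?_⟩
  · refine N.closure_subset_closure (fun e he => ?_) (hcirc.mem_closure_sdiff_singleton_of_mem hxK)
    have hex : e ≠ x := he.2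
    exact ⟨(hKI e he.1 hex).1, (hKI e he.1 hex).2, hmin e (hswap e he.1 hex)⟩
  · refine N.closure_subset_closure (fun e he => ?_) (hcirc.mem_closure_sdiff_singleton_of_mem hcK)
    by_cases hex : e = x
    · exact Or.inl hex
    · exact Or.inr ⟨(hKI e he.1 hex).1, (hKI e he.1 hex).2, he.2, hmin e (hswap e he.1 hex)⟩

/-- The element of `C_x` chosen in the `l`-th matroid. -/
def IsChosen (M : Matchoid ι X p) (f : Finset X → ℝ) (x : X) (S : List X) (l : ι) (c : X) :
    Prop :=
  x ∈ (M.matroid l).E ∧ ¬ (M.matroid l).Indep (insert x ({z | z ∈ S} ∩ (M.matroid l).E)) ∧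
    (swaps M x S l).argmin (incr f S) = some c

theorem mem_exchange {M : Matchoid ι X p} {f : Finset X → ℝ} {x : X} {S : List X} {c : X} :
    c ∈ exchange M f x S ↔ c ∈ S ∧ ∃ l, IsChosen M f x S l c := by
  simp [exchange, IsChosen]

theorem IsChosen.mem {M : Matchoid ι X p} {f : Finset X → ℝ} {x : X} {S : List X} {l : ι} {c : X}
    (h : IsChosen M f x S l c) : c ∈ S ∧ c ∈ (M.matroid l).E := by
  have : c ∈ swaps M x S l := List.argmin_mem h.2.2
  simp only [swaps, List.mem_filter, decide_eq_true_eq] at this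
  exact ⟨this.1, this.2.1⟩

theorem IsChosen.mem_exchange {M : Matchoid ι X p} {f : Finset X → ℝ} {x : X} {S : List X} {l : ι}
    {c : X} (h : IsChosen M f x S l c) : c ∈ exchange M f x S :=
  MultipassStreaming.mem_exchange.2 ⟨h.mem.1, l, h⟩

theorem IsChosen.unique {M : Matchoid ι X p} {f : Finset X → ℝ} {x : X} {S : List X} {l : ι}
    {c d : X} (h : IsChosen M f x S l c) (h' : IsChosen M f x S l d) : c = d :=
  Option.some.inj (h.2.2.symm.trans h'.2.2)

theorem indep_exchange {M : Matchoid ι X p} (f : Finset X → ℝ) {S : List X} {x : X}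
    (hS : M.Indep S.toFinset) (hx : M.Indep {x}) :
    M.Indep (insert x (S.toFinset \ exchange M f x S)) := by
  intro l
  by_cases hxE : x ∈ (M.matroid l).E
  · by_cases hdep : (M.matroid l).Indep (insert x ({z | z ∈ S} ∩ (M.matroid l).E))
    · refine hdep.subset fun z hz => ?_
      rcases Finset.mem_insert.1 hz.1 with h | h
      · exact Or.inl h
      · exact Or.inr ⟨List.mem_toFinset.1 (Finset.mem_sdiff.1 h).1, hz.2⟩
    · obtain ⟨c, hc, -, -, -, hci, -⟩ := exists_argmin_swaps (incr f S) hS hx hxE hdep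
      refine hci.subset fun z hz => ?_
      rcases Finset.mem_insert.1 hz.1 with h | h
      · exact Or.inl h
      · obtain ⟨h1, h2⟩ := Finset.mem_sdiff.1 h
        refine Or.inr ⟨⟨List.mem_toFinset.1 h1, hz.2⟩, fun hzc => h2 ?_⟩
        rw [Set.mem_singleton_iff.1 hzc]
        exact IsChosen.mem_exchange ⟨hxE, hdep, hc⟩
  · refine (hS l).subset fun z hz => ⟨?_, hz.2⟩
    rcases Finset.mem_insert.1 hz.1 with h | h
    · exact absurd (h ▸ hz.2) hxE
    · exact (Finset.mem_sdiff.1 h).1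

end Exchange

/-! ### Rank and the number of matroids at an element -/

section Rank

variable {ι : Type v} {X : Type u} [Fintype X] {p : ℕ}

theorem Matchoid.Indep.card_le_rank {M : Matchoid ι X p} {S : Finset X} (hS : M.Indep S) :
    S.card ≤ M.rank := by
  classical
  exact Finset.le_sup (f := Finset.card) (by simpa using hS)

/-- The matroids of a `p`-matchoid with a nonempty ground set. -/
noncomputable def Matchoid.support (M : Matchoid ι X p) : Finset ι :=
  (Set.finite_iUnion (ι := X) (f := fun x => {l | x ∈ (M.matroid l).E}) fun x =>
    Set.finite_of_encard_le_coe (M.degree_le x)).toFinset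

theorem Matchoid.mem_support {M : Matchoid ι X p} {l : ι} {x : X} (h : x ∈ (M.matroid l).E) :
    l ∈ M.support := by
  simp only [Matchoid.support, Set.Finite.mem_toFinset, Set.mem_iUnion]
  exact ⟨x, h⟩

open scoped Classical in
theorem Matchoid.card_filter_le (M : Matchoid ι X p) (x : X) :
    (M.support.filter fun l => x ∈ (M.matroid l).E).card ≤ p := by
  have h := M.degree_le x
  have h2 : (↑(M.support.filter fun l => x ∈ (M.matroid l).E) : Set ι).encard ≤ p := by
    refine (Set.encard_le_encard fun l hl => ?_).trans h
    exact (Finset.mem_filter.1 hl).2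
  rw [Set.encard_coe_eq_coe_finsetCard] at h2
  exact_mod_cast h2

end Rank

/-! ### The effect of one exchange on the solution -/

section Solutions

variable {ι : Type v} {X : Type u} [DecidableEq X] {p : ℕ}

/-- The properties of the current solution that every exchange preserves. -/
structure IsSolution (M : Matchoid ι X p) (f : Finset X → ℝ) (S : List X) : Prop where
  nodup : S.Nodup
  indep : M.Indep S.toFinset
  incr_nonneg : ∀ e ∈ S, 0 ≤ incr f S e

theorem isSolution_nil (M : Matchoid ι X p) (f : Finset X → ℝ) : IsSolution M f [] :=
  ⟨List.nodup_nil, by simpa using M.indep_empty, by simp⟩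

variable {M : Matchoid ι X p} {f : Finset X → ℝ} {α β : ℝ} {S : List X} {y : X}

theorem IsSolution.incr_nonneg_exchange (hS : IsSolution M f S) (x : X) :
    ∀ e ∈ exchange M f x S, 0 ≤ incr f S e :=
  fun e he => hS.incr_nonneg e (mem_exchange.1 he).1

theorem toFinset_exchange {q : X → Bool} (hq : ∀ z, q z = true ↔ z ∉ exchange M f y S) :
    (S.filter q ++ [y]).toFinset = insert y (S.toFinset \ exchange M f y S) := by
  ext z
  simp only [List.mem_toFinset, List.mem_append, List.mem_filter, hq, List.mem_singleton,
    Finset.mem_insert, Finset.mem_sdiff]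
  tauto

theorem le_incr_exchange (hf : Submodular f) (hyS : y ∉ S) (q : X → Bool) :
    marginal f y S.toFinset ≤ incr f (S.filter q ++ [y]) y := by
  rw [incr_append_self _ fun h => hyS (List.mem_of_mem_filter h)]
  refine hf.marginal_anti (fun z hz => ?_) (by simpa using hyS)
  rw [List.mem_toFinset] at hz ⊢
  exact List.mem_of_mem_filter hz

/-- Removing the exchanged elements costs at most their increments, and y gains at least as much
over the smaller set as over S. -/
theorem add_marginal_sub_le_exchange (hf : Submodular f) (hS : S.Nodup) (hyS : y ∉ S)
    {q : X → Bool} (hq : ∀ z, q z = true ↔ z ∉ exchange M f y S) :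
    f S.toFinset + marginal f y S.toFinset - ∑ e ∈ exchange M f y S, incr f S e ≤
      f (S.filter q ++ [y]).toFinset := by
  have h1 := hf.sub_filter_le S hS q
  have h2 : (S.filter q).toFinset = S.toFinset \ exchange M f y S := by
    ext z; simp [hq]
  have h3 : S.toFinset.filter (fun e => q e = false) = exchange M f y S := by
    ext z
    have := hq z
    have h4 : z ∈ exchange M f y S → z ∈ S := fun h => (mem_exchange.1 h).1
    cases hz : q z <;> simp_all
  rw [h2, h3] at h1
  rw [toFinset_exchange hq]
  have h5 := hf.marginal_anti (S := S.toFinset \ exchange M f y S) (T := S.toFinset)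
    Finset.sdiff_subset (x := y) (by simpa using hyS)
  unfold marginal at h5 ⊢
  linarith

/-- The gain has two uses: α bounds the number of exchanges, and the multiple β of the evicted
increments bounds the total weight ever evicted. -/
theorem Good.add_le_exchange (hf : Submodular f) (hS : S.Nodup) (hyS : y ∉ S)
    (hy : Good M f α β S y) {q : X → Bool} (hq : ∀ z, q z = true ↔ z ∉ exchange M f y S) :
    f S.toFinset + α + β * ∑ e ∈ exchange M f y S, incr f S e ≤
      f (S.filter q ++ [y]).toFinset := by
  have h1 := add_marginal_sub_le_exchange hf hS hyS hq
  have h2 := hy.2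
  linarith

theorem Good.marginal_nonneg (hS : IsSolution M f S) (hα : 0 ≤ α) (hβ : 0 ≤ β)
    (hy : Good M f α β S y) : 0 ≤ marginal f y S.toFinset := by
  have h := Finset.sum_nonneg (hS.incr_nonneg_exchange y)
  have : 0 ≤ (1 + β) * ∑ e ∈ exchange M f y S, incr f S e := by positivity
  linarith [hy.2]

theorem Good.incr_le_marginal (hS : IsSolution M f S) (hα : 0 ≤ α) (hβ : 0 ≤ β)
    (hy : Good M f α β S y) {c : X} (hc : c ∈ exchange M f y S) :
    incr f S c ≤ marginal f y S.toFinset := by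
  have h := Finset.sum_nonneg (hS.incr_nonneg_exchange y)
  have h2 := Finset.single_le_sum (hS.incr_nonneg_exchange y) hc
  have h3 := hy.2
  nlinarith

theorem IsSolution.exchange (hf : Submodular f) (hα : 0 ≤ α) (hβ : 0 ≤ β)
    (hS : IsSolution M f S) (hyS : y ∉ S) (hy : Good M f α β S y) {q : X → Bool}
    (hq : ∀ z, q z = true ↔ z ∉ exchange M f y S) : IsSolution M f (S.filter q ++ [y]) where
  nodup := by
    rw [List.nodup_append]
    refine ⟨hS.nodup.filter _, by simp, fun a ha b hb => ?_⟩
    rw [List.mem_singleton.1 hb]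
    rintro rfl
    exact hyS (List.mem_of_mem_filter ha)
  indep := by
    rw [toFinset_exchange hq]
    exact indep_exchange f hS.indep hy.1
  incr_nonneg := fun e he => by
    rcases List.mem_append.1 he with h | h
    · obtain ⟨h1, h2⟩ := List.mem_filter.1 h
      exact (hS.incr_nonneg e h1).trans (hf.incr_le_incr_filter S q y e h1 h2)
    · rw [List.mem_singleton.1 h]
      exact (hy.marginal_nonneg hS hα hβ).trans (le_incr_exchange hf hyS q)

end Solutions

/-! ### The history of a pass and its invariants -/

section Pass

variable {ι : Type v} {X : Type u} [Fintype X] [DecidableEq X] {p : ℕ}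

/-- The element `x` was rejected: its marginal value is bounded by values `v l` of elements of the
`l`-th matroid, and `x` is spanned by those elements of `Z l` whose weight is at least `v l`. -/
def IsRejected (M : Matchoid ι X p) (f : Finset X → ℝ) (α β : ℝ) (A : Finset X) (w : X → ℝ)
    (Z : ι → Finset X) (x : X) : Prop :=
  ∃ v : ι → ℝ, marginal f x A ≤ α + (1 + β) * ∑ l ∈ M.support, v l ∧
    ∀ l, 0 ≤ v l ∧ (0 < v l → x ∈ (M.matroid l).closure {e | e ∈ Z l ∧ v l ≤ w e})

/-- The history of a pass over the elements of `P`, which started with the solution `S₀` and has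
led to the solution `S` and the buffer `B`: `A` consists of the elements that have been in the
solution, `w` gives their last incremental values, and `Z l` consists of the elements of
`A ∩ X_l` that have not been removed on account of the `l`-th matroid. -/
structure PassHistory (M : Matchoid ι X p) (f : Finset X → ℝ) (α β : ℝ) (S₀ : List X)
    (P : Set X) (S : List X) (B : Finset X) (A : Finset X) (w : X → ℝ) (Z : ι → Finset X) :
    Prop where
  sol : IsSolution M f S
  start_subset : S₀.toFinset ⊆ A
  subset : S.toFinset ⊆ A
  le_processed : ∀ x ∈ A, x ∈ S₀ ∨ x ∈ P
  buf_processed : ∀ x ∈ B, x ∈ P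
  buf_disjoint : ∀ x ∈ B, x ∉ A
  buf_good : ∀ x ∈ B, Good M f α β S x
  weight_eq : ∀ e ∈ S, w e = incr f S e
  weight_nonneg : ∀ e ∈ A, 0 ≤ w e
  Z_subset : ∀ l, Z l ⊆ A
  Z_ground : ∀ l, ∀ e ∈ Z l, e ∈ (M.matroid l).E
  mem_Z : ∀ l, ∀ e ∈ S, e ∈ (M.matroid l).E → e ∈ Z l
  exists_notMem_Z : ∀ e ∈ A, e ∉ S → ∃ l, e ∈ (M.matroid l).E ∧ e ∉ Z l
  value_le : f A ≤ f S.toFinset + ∑ e ∈ A \ S.toFinset, w e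
  le_value : f S₀.toFinset + β * ∑ e ∈ A \ S.toFinset, w e ≤ f S.toFinset
  processed : ∀ x ∈ P, x ∈ A ∨ x ∈ B ∨ ¬ M.Indep {x} ∨ IsRejected M f α β A w Z x

variable {M : Matchoid ι X p} {f : Finset X → ℝ} {α β : ℝ} {S₀ S : List X} {P : Set X}
  {B A : Finset X} {w : X → ℝ} {Z : ι → Finset X}

theorem IsSolution.passHistory (hS : IsSolution M f S) (α β : ℝ) :
    ∃ w Z, PassHistory M f α β S ∅ S ∅ S.toFinset w Z := by
  classical
  refine ⟨incr f S, fun l => S.toFinset.filter fun e => e ∈ (M.matroid l).E, ?_⟩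
  constructor <;> simp_all [hS.incr_nonneg]

/-- The failed test bounds the marginal value over S, hence over the larger set A. The charge to a
matroid is the increment of the element chosen there; since that element is lightest on its circuit,
x is spanned by elements of S that weigh at least the charge. -/
theorem isRejected_of_not_good (hf : Submodular f) (hβ : 0 ≤ β) (hS : IsSolution M f S)
    (hSA : S.toFinset ⊆ A) (hw : ∀ e ∈ S, w e = incr f S e)
    (hZ : ∀ l, ∀ e ∈ S, e ∈ (M.matroid l).E → e ∈ Z l) {x : X} (hxA : x ∉ A) (hx : M.Indep {x})
    (hbad : ¬ Good M f α β S x) : IsRejected M f α β A w Z x := by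
  classical
  have hnn := hS.incr_nonneg
  -- The value 0 in matroids without a conflict imposes no spanning condition.
  let v : ι → ℝ := fun l => if hl : ∃ c, IsChosen M f x S l c then incr f S hl.choose else 0
  have hv : ∀ l c, IsChosen M f x S l c → v l = incr f S c := fun l c hc => by
    have hl : ∃ c, IsChosen M f x S l c := ⟨c, hc⟩
    simp only [v, dif_pos hl]
    rw [hl.choose_spec.unique hc]
  have hv0 : ∀ l, 0 ≤ v l := fun l => by
    by_cases hl : ∃ c, IsChosen M f x S l c
    · obtain ⟨c, hc⟩ := hl
      rw [hv l c hc]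
      exact hnn c hc.mem.1
    · simp [v, hl]
  -- An element chosen by several matroids is counted once on the left. Assigning to each element
  -- one matroid that chose it is injective, because a matroid chooses only one element.
  have hsum : ∑ e ∈ exchange M f x S, incr f S e ≤ ∑ l ∈ M.support, v l := by
    have hex : ∀ e ∈ exchange M f x S, ∃ l, IsChosen M f x S l e := fun e he =>
      (mem_exchange.1 he).2
    rcases (exchange M f x S).eq_empty_or_nonempty with hemp | ⟨e₀, he₀⟩
    · rw [hemp, Finset.sum_empty]
      exact Finset.sum_nonneg fun l _ => hv0 l
    have : Nonempty ι := ⟨(hex e₀ he₀).choose⟩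
    choose! g hg using hex
    have hinj : Set.InjOn g (exchange M f x S : Set X) := fun e he e' he' hee =>
      (hg e he).unique (hee ▸ hg e' he')
    calc ∑ e ∈ exchange M f x S, incr f S e
        = ∑ e ∈ exchange M f x S, v (g e) :=
          Finset.sum_congr rfl fun e he => (hv _ _ (hg e he)).symm
      _ = ∑ l ∈ (exchange M f x S).image g, v l := (Finset.sum_image hinj).symm
      _ ≤ ∑ l ∈ M.support, v l := by
          refine Finset.sum_le_sum_of_subset_of_nonneg (fun l hl => ?_) fun l _ _ => hv0 l
          obtain ⟨e, he, rfl⟩ := Finset.mem_image.1 hl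
          exact M.mem_support (hg e he).1
  refine ⟨v, ?_, fun l => ⟨hv0 l, fun hpos => ?_⟩⟩
  · have h1 : marginal f x S.toFinset < α + (1 + β) * ∑ e ∈ exchange M f x S, incr f S e := by
      by_contra hc
      exact hbad ⟨hx, not_lt.1 hc⟩
    have h2 := hf.marginal_anti hSA hxA
    have h3 : (1 + β) * ∑ e ∈ exchange M f x S, incr f S e ≤ (1 + β) * ∑ l ∈ M.support, v l :=
      mul_le_mul_of_nonneg_left hsum (by linarith)
    linarith
  · obtain ⟨c, hc⟩ : ∃ c, IsChosen M f x S l c := by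
      by_contra hl
      simp [v, hl] at hpos
    obtain ⟨c', hc', -, -, -, -, hcl, -⟩ :=
      exists_argmin_swaps (incr f S) hS.indep hx hc.1 hc.2.1
    have : c' = c := Option.some.inj (hc'.symm.trans hc.2.2)
    subst this
    refine (M.matroid l).closure_subset_closure (fun e he => ?_) hcl
    refine ⟨hZ l e he.1 he.2.1, ?_⟩
    rw [hw e he.1, hv l _ hc]
    exact he.2.2

/-- The arrival of an element, before an exchange takes place. -/
theorem PassHistory.arrive (hf : Submodular f) (hβ : 0 ≤ β)
    (h : PassHistory M f α β S₀ P S B A w Z) {x : X} (hxP : x ∉ P) {B' : Finset X}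
    (hB' : (x ∉ S₀ ∧ Good M f α β S x) ∧ B' = insert x B ∨
      ¬ (x ∉ S₀ ∧ Good M f α β S x) ∧ B' = B) :
    PassHistory M f α β S₀ (insert x P) S B' A w Z := by
  have hmem : ∀ z ∈ B', z ∈ B ∨ z = x ∧ x ∉ S₀ ∧ Good M f α β S x := by
    rcases hB' with ⟨h1, rfl⟩ | ⟨h1, rfl⟩
    · intro z hz
      rcases Finset.mem_insert.1 hz with h2 | h2
      exacts [Or.inr ⟨h2, h1⟩, Or.inl h2]
    · exact fun z hz => Or.inl hz
  have hsub : B ⊆ B' := by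
    rcases hB' with ⟨h1, rfl⟩ | ⟨h1, rfl⟩
    exacts [Finset.subset_insert _ _, subset_rfl]
  refine { h with le_processed := ?_, buf_processed := ?_, buf_disjoint := ?_, buf_good := ?_,
                  processed := ?_ }
  · exact fun z hz => (h.le_processed z hz).imp_right (Or.inr ·)
  · intro z hz
    rcases hmem z hz with h1 | h1
    exacts [Or.inr (h.buf_processed z h1), Or.inl h1.1]
  · intro z hz hzA
    rcases hmem z hz with h1 | h1
    · exact h.buf_disjoint z h1 hzA
    · obtain ⟨rfl, h2, -⟩ := h1
      exact (h.le_processed z hzA).elim h2 hxP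
  · intro z hz
    rcases hmem z hz with h1 | ⟨rfl, -, h2⟩
    exacts [h.buf_good z h1, h2]
  · rintro z (rfl | hz)
    · by_cases hzA : z ∈ A
      · exact Or.inl hzA
      refine Or.inr ?_
      rcases hB' with ⟨h1, rfl⟩ | ⟨h1, rfl⟩
      · exact Or.inl (Finset.mem_insert_self _ _)
      · refine Or.inr (or_iff_not_imp_left.2 fun hi => ?_)
        refine isRejected_of_not_good hf hβ h.sol h.subset h.weight_eq h.mem_Z hzA (not_not.1 hi) fun hg => h1 ⟨fun hz0 => ?_, hg⟩
        exact hzA (h.start_subset (List.mem_toFinset.2 hz0))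
    · rcases h.processed z hz with h1 | h1 | h1
      exacts [Or.inl h1, Or.inr (Or.inl (hsub h1)), Or.inr (Or.inr h1)]

/-- An exchange never shrinks the span of the elements of large weight. -/
theorem IsRejected.mono (hf : Submodular f) {A' : Finset X} {w' : X → ℝ} {Z' : ι → Finset X}
    {x : X} (h : IsRejected M f α β A w Z x) (hA : A ⊆ A') (hx : x ∉ A')
    (hZ : ∀ l θ, (M.matroid l).closure {e | e ∈ Z l ∧ θ ≤ w e} ⊆
      (M.matroid l).closure {e | e ∈ Z' l ∧ θ ≤ w' e}) : IsRejected M f α β A' w' Z' x := by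
  obtain ⟨v, h1, h2⟩ := h
  exact ⟨v, (hf.marginal_anti hA hx).trans h1, fun l => ⟨(h2 l).1, fun hl => hZ l _ ((h2 l).2 hl)⟩⟩

/-- An exchange of an element of the buffer. -/
theorem PassHistory.exchange (hf : Submodular f) (hα : 0 ≤ α) (hβ : 0 ≤ β)
    (h : PassHistory M f α β S₀ P S B A w Z) {y : X} (hy : y ∈ B) {q : X → Bool}
    (hq : ∀ z, q z = true ↔ z ∉ exchange M f y S) {B' : Finset X}
    (hB' : ∀ z, z ∈ B' ↔ z ≠ y ∧ z ∈ B ∧ Good M f α β (S.filter q ++ [y]) z) :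
    ∃ w' Z', PassHistory M f α β S₀ P (S.filter q ++ [y]) B' (insert y A) w' Z' := by
  classical
  set S' := S.filter q ++ [y] with hS'
  set C := MultipassStreaming.exchange M f y S with hC
  have hyA : y ∉ A := h.buf_disjoint y hy
  have hyS : y ∉ S := fun hc => hyA (h.subset (List.mem_toFinset.2 hc))
  have hgood := h.buf_good y hy
  have hCS : ∀ e ∈ C, e ∈ S := fun e he => (mem_exchange.1 he).1
  have hSA : ∀ e ∈ S, e ∈ A := fun e he => h.subset (List.mem_toFinset.2 he)
  have hmemS' : ∀ z, z ∈ S' ↔ z = y ∨ z ∈ S ∧ z ∉ C := fun z => by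
    rw [hS', List.mem_append, List.mem_filter, hq, List.mem_singleton, or_comm]
  -- Elements of the new solution get their current increments, which have not fallen; evicted
  -- elements keep their last weight.
  let w' : X → ℝ := fun e => if e ∈ S' then incr f S' e else w e
  have hw' : ∀ e ∈ S', w' e = incr f S' e := fun e he => if_pos he
  have hw'n : ∀ e, e ∉ S' → w' e = w e := fun e he => if_neg he
  have hww' : ∀ e ∈ A, w e ≤ w' e := fun e he => by
    by_cases heS' : e ∈ S'
    · rcases (hmemS' e).1 heS' with rfl | ⟨heS, heC⟩
      · exact absurd he hyA
      · rw [hw' e heS', h.weight_eq e heS]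
        exact hf.incr_le_incr_filter S q y e heS ((hq e).2 heC)
    · rw [hw'n e heS']
  have hyw : marginal f y S.toFinset ≤ w' y := by
    rw [hw' y ((hmemS' y).2 (Or.inl rfl))]
    exact le_incr_exchange hf hyS q
  let Z' : ι → Finset X := fun l =>
    (insert y A).filter fun e => e ∈ (M.matroid l).E ∧
      (e = y ∨ e ∈ Z l ∧ ¬ IsChosen M f y S l e)
  have hmemZ' : ∀ l e, e ∈ Z' l ↔ e ∈ (M.matroid l).E ∧
      (e = y ∨ e ∈ Z l ∧ ¬ IsChosen M f y S l e) := fun l e => by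
    simp only [Z', Finset.mem_filter, Finset.mem_insert, and_iff_right_iff_imp]
    rintro ⟨-, h1 | h1⟩
    exacts [Or.inl h1, Or.inr (h.Z_subset l h1.1)]
  -- Only the element c evicted on account of l leaves Z l. It is spanned by y and by elements of S
  -- at least as heavy as c, and y itself is at least as heavy because it passed the test. Hence
  -- every superlevel set that contained c still spans it.
  have hZZ' : ∀ l θ, (M.matroid l).closure {e | e ∈ Z l ∧ θ ≤ w e} ⊆
      (M.matroid l).closure {e | e ∈ Z' l ∧ θ ≤ w' e} := fun l θ => by
    refine (M.matroid l).closure_subset_closure_of_subset_closure fun e he => ?_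
    have hZ'E : {e | e ∈ Z' l ∧ θ ≤ w' e} ⊆ (M.matroid l).E := fun z hz => ((hmemZ' l z).1 hz.1).1
    have heA := h.Z_subset l he.1
    by_cases hch : IsChosen M f y S l e
    · obtain ⟨c, hc, hcS, hcE, -, -, -, hcl⟩ :=
        exists_argmin_swaps (incr f S) h.sol.indep hgood.1 hch.1 hch.2.1
      have : c = e := Option.some.inj (hc.symm.trans hch.2.2)
      subst this
      have hθ : θ ≤ incr f S c := by rw [← h.weight_eq c hcS]; exact he.2
      refine (M.matroid l).closure_subset_closure (fun z hz => ?_) hcl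
      rcases hz with rfl | ⟨hzS, hzE, hzc, hz⟩
      · refine ⟨(hmemZ' l z).2 ⟨hch.1, Or.inl rfl⟩, hθ.trans (le_trans ?_ hyw)⟩
        exact hgood.incr_le_marginal h.sol hα hβ hch.mem_exchange
      · refine ⟨(hmemZ' l z).2 ⟨hzE, Or.inr ⟨h.mem_Z l z hzS hzE, fun h' => ?_⟩⟩, ?_⟩
        · exact hzc (h'.unique hch)
        · refine hθ.trans (hz.trans ?_)
          rw [← h.weight_eq z hzS]
          exact hww' z (hSA z hzS)
    · exact (M.matroid l).subset_closure _ hZ'E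
        ⟨(hmemZ' l e).2 ⟨h.Z_ground l e he.1, Or.inr ⟨he.1, hch⟩⟩, he.2.trans (hww' e heA)⟩
  have hsol : IsSolution M f S' := h.sol.exchange hf hα hβ hyS hgood hq
  have htoF : S'.toFinset = insert y (S.toFinset \ C) := toFinset_exchange hq
  -- The evicted set grows exactly by C, so the evicted weight grows by the increments that enter
  -- the value estimates for the exchange.
  have hdiff : insert y A \ S'.toFinset = (A \ S.toFinset) ∪ C := by
    ext z
    simp only [Finset.mem_sdiff, Finset.mem_insert, List.mem_toFinset, hmemS', Finset.mem_union]
    have h1 := hCS z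
    have h2 := hSA z
    constructor
    · rintro ⟨h3 | h3, h4⟩
      · exact absurd (Or.inl h3) h4
      · tauto
    · rintro (⟨h3, h4⟩ | h3)
      · refine ⟨Or.inr h3, ?_⟩
        rintro (rfl | h5)
        exacts [hyA h3, h4 h5.1]
      · refine ⟨Or.inr (h2 (h1 h3)), ?_⟩
        rintro (rfl | h5)
        exacts [hyS (h1 h3), h5.2 h3]
  have hdisj : Disjoint (A \ S.toFinset) C := Finset.disjoint_left.2 fun z hz hzC =>
    (Finset.mem_sdiff.1 hz).2 (List.mem_toFinset.2 (hCS z hzC))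
  have hsum : ∑ e ∈ insert y A \ S'.toFinset, w' e =
      ∑ e ∈ A \ S.toFinset, w e + ∑ e ∈ C, incr f S e := by
    have h1 : ∑ e ∈ insert y A \ S'.toFinset, w' e = ∑ e ∈ insert y A \ S'.toFinset, w e :=
      Finset.sum_congr rfl fun e he => hw'n e fun hc =>
        (Finset.mem_sdiff.1 he).2 (List.mem_toFinset.2 hc)
    rw [h1, hdiff, Finset.sum_union hdisj]
    congr 1
    exact Finset.sum_congr rfl fun e he => h.weight_eq e (hCS e he)
  have hS'A : S'.toFinset ⊆ insert y A := by
    rw [htoF]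
    exact Finset.insert_subset_insert _ (Finset.sdiff_subset.trans h.subset)
  have hS'Z : ∀ l, ∀ e ∈ S', e ∈ (M.matroid l).E → e ∈ Z' l := by
    intro l e he heE
    refine (hmemZ' l e).2 ⟨heE, ?_⟩
    rcases (hmemS' e).1 he with h1 | ⟨h1, h2⟩
    · exact Or.inl h1
    · exact Or.inr ⟨h.mem_Z l e h1 heE, fun h3 => h2 h3.mem_exchange⟩
  refine ⟨w', Z', ?_⟩
  constructor
  · exact hsol
  · exact h.start_subset.trans (Finset.subset_insert _ _)
  · exact hS'A
  · intro z hz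
    rcases Finset.mem_insert.1 hz with rfl | hz
    exacts [Or.inr (h.buf_processed z hy), h.le_processed z hz]
  · exact fun z hz => h.buf_processed z ((hB' z).1 hz).2.1
  · intro z hz hzA
    obtain ⟨h1, h2, -⟩ := (hB' z).1 hz
    exact h.buf_disjoint z h2 ((Finset.mem_insert.1 hzA).resolve_left h1)
  · exact fun z hz => ((hB' z).1 hz).2.2
  · exact hw'
  · intro e he
    rcases Finset.mem_insert.1 he with rfl | he
    · exact (hgood.marginal_nonneg h.sol hα hβ).trans hyw
    · exact (h.weight_nonneg e he).trans (hww' e he)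
  · exact fun l => Finset.filter_subset _ _
  · exact fun l e he => ((hmemZ' l e).1 he).1
  · exact hS'Z
  · intro e he heS'
    have hey : e ≠ y := fun hc => heS' ((hmemS' e).2 (Or.inl hc))
    have heA := (Finset.mem_insert.1 he).resolve_left hey
    by_cases heS : e ∈ S
    · have heC : e ∈ C := by
        by_contra hc
        exact heS' ((hmemS' e).2 (Or.inr ⟨heS, hc⟩))
      obtain ⟨l, hl⟩ := (mem_exchange.1 heC).2
      exact ⟨l, hl.mem.2, fun hc => (((hmemZ' l e).1 hc).2.resolve_left hey).2 hl⟩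
    · obtain ⟨l, h1, h2⟩ := h.exists_notMem_Z e heA heS
      exact ⟨l, h1, fun hc => h2 (((hmemZ' l e).1 hc).2.resolve_left hey).1⟩
  · rw [hsum]
    have h1 := add_marginal_sub_le_exchange hf h.sol.nodup hyS hq
    have h2 := hf.marginal_anti h.subset hyA
    have h3 := h.value_le
    rw [marginal] at h2
    linarith
  · rw [hsum]
    have h1 := hgood.add_le_exchange hf h.sol.nodup hyS hq
    have h3 := h.le_value
    linarith
  · intro x hxP
    by_cases hxA : x ∈ insert y A
    · exact Or.inl hxA
    refine Or.inr ?_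
    rw [Finset.mem_insert, not_or] at hxA
    have hrest : ∀ hx : M.Indep {x}, IsRejected M f α β A w Z x →
        IsRejected M f α β (insert y A) w' Z' x := fun _ hr =>
      hr.mono hf (Finset.subset_insert _ _) (by simp [hxA]) hZZ'
    rcases h.processed x hxP with h1 | h1 | h1 | h1
    · exact absurd h1 hxA.2
    · by_cases hg : Good M f α β S' x
      · exact Or.inl ((hB' x).2 ⟨hxA.1, h1, hg⟩)
      · exact Or.inr (Or.inr (isRejected_of_not_good hf hβ hsol hS'A hw' hS'Z
          (by simp [hxA]) (h.buf_good x h1).1 hg))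
    · exact Or.inr (Or.inl h1)
    · exact Or.inr (or_iff_not_imp_left.2 fun hi => hrest (not_not.1 hi) h1)

end Pass

/-! ### The guarantee of a complete pass -/

section PassBound

variable {ι : Type v} {X : Type u} [Fintype X] [DecidableEq X] {p : ℕ}
variable {M : Matchoid ι X p} {f : Finset X → ℝ} {α β : ℝ} {S₀ S : List X} {P : Set X}
  {B A : Finset X} {w : X → ℝ} {Z : ι → Finset X}

/-- For θ > 0 the elements of R with charge at least θ are independent in the l-th matroid and
spanned by the elements of Z l of weight at least θ, so they are no more numerous. Comparing all
levels compares the sums. -/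
theorem PassHistory.sum_rejected_le (h : PassHistory M f α β S₀ P S B A w Z) {R : Finset X}
    (hR : M.Indep R) (l : ι) (v : X → ℝ)
    (hspan : ∀ x ∈ R, 0 < v x → x ∈ (M.matroid l).closure {e | e ∈ Z l ∧ v x ≤ w e}) :
    ∑ x ∈ R, v x ≤ ∑ e ∈ Z l, w e := by
  refine sum_le_sum_of_card_superlevel R (Z l) v w
    (fun z hz => h.weight_nonneg z (h.Z_subset l hz)) fun θ hθ => ?_
  set N := M.matroid l
  have hsub : (↑(R.filter fun x => θ ≤ v x) : Set X) ⊆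
      N.closure ↑((Z l).filter fun z => θ ≤ w z) := fun x hx => by
    obtain ⟨hxR, hxθ⟩ := Finset.mem_filter.1 (Finset.mem_coe.1 hx)
    refine N.closure_subset_closure (fun e he => ?_) (hspan x hxR (hθ.trans_le hxθ))
    rw [Finset.coe_filter]
    exact ⟨he.1, hxθ.trans he.2⟩
  have hind : N.Indep ↑(R.filter fun x => θ ≤ v x) := by
    refine (hR l).subset fun x hx => ⟨?_, N.closure_subset_ground _ (hsub hx)⟩
    exact (Finset.mem_filter.1 (Finset.mem_coe.1 hx)).1
  have h1 := (hind.encard_le_eRk_of_subset hsub).trans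
    ((N.eRk_closure_eq _).le.trans (N.eRk_le_encard _))
  rw [Set.encard_coe_eq_coe_finsetCard, Set.encard_coe_eq_coe_finsetCard] at h1
  exact_mod_cast h1

/-- Double counting. The p - 1 for evicted elements is essential: each has left Z l for some matroid
containing it. This saving yields the term p / β + p - 1 that drives the improvement between passes.
-/
theorem PassHistory.sum_Z_le (h : PassHistory M f α β S₀ P S B A w Z) :
    ∑ l ∈ M.support, ∑ e ∈ Z l, w e ≤
      p * ∑ e ∈ S.toFinset, w e + ((p : ℝ) - 1) * ∑ e ∈ A \ S.toFinset, w e := by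
  classical
  have h1 : ∑ l ∈ M.support, ∑ e ∈ Z l, w e =
      ∑ e ∈ A, ((M.support.filter fun l => e ∈ Z l).card : ℝ) * w e := by
    calc ∑ l ∈ M.support, ∑ e ∈ Z l, w e
        = ∑ l ∈ M.support, ∑ e ∈ A, if e ∈ Z l then w e else 0 := by
          refine Finset.sum_congr rfl fun l _ => ?_
          rw [← Finset.sum_filter, Finset.filter_mem_eq_inter,
            Finset.inter_eq_right.2 (h.Z_subset l)]
      _ = ∑ e ∈ A, ∑ l ∈ M.support, if e ∈ Z l then w e else 0 := Finset.sum_comm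
      _ = _ := by
          refine Finset.sum_congr rfl fun e _ => ?_
          rw [← Finset.sum_filter, Finset.sum_const, nsmul_eq_mul]
  rw [h1, ← Finset.sum_sdiff h.subset, add_comm, Finset.mul_sum, Finset.mul_sum]
  refine add_le_add (Finset.sum_le_sum fun e he => ?_) (Finset.sum_le_sum fun e he => ?_)
  · refine mul_le_mul_of_nonneg_right ?_ (h.weight_nonneg e (h.subset he))
    have : (M.support.filter fun l => e ∈ Z l).card ≤ p :=
      (Finset.card_le_card (Finset.monotone_filter_right _ fun l _ hl => h.Z_ground l e hl)).trans
        (M.card_filter_le e)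
    exact_mod_cast this
  · obtain ⟨heA, heS⟩ := Finset.mem_sdiff.1 he
    refine mul_le_mul_of_nonneg_right ?_ (h.weight_nonneg e heA)
    obtain ⟨l₀, h2, h3⟩ := h.exists_notMem_Z e heA fun hc => heS (List.mem_toFinset.2 hc)
    have : (M.support.filter fun l => e ∈ Z l).card < p := by
      refine (Finset.card_lt_card (Finset.ssubset_iff_subset_ne.2
        ⟨Finset.monotone_filter_right _ fun l _ hl => h.Z_ground l e hl, fun hc => ?_⟩)).trans_le
        (M.card_filter_le e)
      have : l₀ ∈ M.support.filter fun l => e ∈ Z l := by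
        rw [hc]
        exact Finset.mem_filter.2 ⟨M.mem_support h2, h2⟩
      exact h3 (Finset.mem_filter.1 this).2
    have h4 : (((M.support.filter fun l => e ∈ Z l).card + 1 : ℕ) : ℝ) ≤ p := by exact_mod_cast this
    push_cast at h4
    linarith

/-- The guarantee of a complete pass. -/
theorem PassHistory.optimal_le (hf : Submodular f) (h0 : ∀ S, 0 ≤ f S) (hp : 1 ≤ p)
    (hα : 0 ≤ α) (hβ : 0 < β) (h : PassHistory M f α β S₀ P S B A w Z) (hP : ∀ x, x ∈ P)
    {O : Finset X} (hO : M.Indep O) :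
    f (O ∪ A) + (p / β + p - 1) * f S₀.toFinset ≤
      M.rank * α + (2 * p + β * p + p / β) * f S.toFinset + f (O ∩ B) := by
  classical
  set R := (O \ B) \ A with hR
  have hRO : R ⊆ O := Finset.sdiff_subset.trans Finset.sdiff_subset
  have hRi : M.Indep R := hO.mono hRO
  have hp' : (1 : ℝ) ≤ p := by exact_mod_cast hp
  have h1 : f (O ∪ A) ≤ f (A ∪ R) + f (O ∩ B) := by
    have h2 := hf (A ∪ R) (O ∩ B)
    have h3 : A ∪ R ∪ (O ∩ B) = O ∪ A := by
      ext z
      simp only [hR, Finset.mem_union, Finset.mem_sdiff, Finset.mem_inter]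
      tauto
    rw [h3] at h2
    linarith [h0 ((A ∪ R) ∩ (O ∩ B))]
  have h2 := hf.union_le_sum_marginal A R Finset.sdiff_disjoint
  have hrej : ∀ x ∈ R, IsRejected M f α β A w Z x := fun x hx => by
    obtain ⟨hx1, hxA⟩ := Finset.mem_sdiff.1 hx
    obtain ⟨hxO, hxB⟩ := Finset.mem_sdiff.1 hx1
    rcases h.processed x (hP x) with h' | h' | h' | h'
    exacts [absurd h' hxA, absurd h' hxB,
      absurd (hO.mono (Finset.singleton_subset_iff.2 hxO)) h', h']
  choose! v hv1 hv2 using hrej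
  have h3 : ∑ x ∈ R, marginal f x A ≤
      M.rank * α + (1 + β) * ∑ l ∈ M.support, ∑ x ∈ R, v x l := by
    calc ∑ x ∈ R, marginal f x A ≤ ∑ x ∈ R, (α + (1 + β) * ∑ l ∈ M.support, v x l) :=
          Finset.sum_le_sum hv1
      _ = R.card * α + (1 + β) * ∑ l ∈ M.support, ∑ x ∈ R, v x l := by
          rw [Finset.sum_add_distrib, Finset.sum_const, nsmul_eq_mul, ← Finset.mul_sum,
            Finset.sum_comm]
      _ ≤ _ := by
          have : (R.card : ℝ) ≤ M.rank := by exact_mod_cast hRi.card_le_rank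
          gcongr
  have h4 : ∑ l ∈ M.support, ∑ x ∈ R, v x l ≤ ∑ l ∈ M.support, ∑ e ∈ Z l, w e :=
    Finset.sum_le_sum fun l _ => h.sum_rejected_le hRi l (fun x => v x l)
      fun x hx => (hv2 x hx l).2
  have h5 := h4.trans h.sum_Z_le
  have h6 : ∑ e ∈ S.toFinset, w e ≤ f S.toFinset := by
    rw [Finset.sum_congr rfl fun e he => h.weight_eq e (List.mem_toFinset.1 he),
      sum_incr S h.sol.nodup]
    linarith [h0 ∅]
  have h7 := h.value_le
  have h8 := h.le_value
  set W := ∑ e ∈ A \ S.toFinset, w e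
  set V := ∑ e ∈ S.toFinset, w e
  set F := f S.toFinset
  set F₀ := f S₀.toFinset
  have h9 : (1 + β) * ∑ l ∈ M.support, ∑ x ∈ R, v x l ≤ (1 + β) * (p * F + (p - 1) * W) := by
    refine mul_le_mul_of_nonneg_left (h5.trans ?_) (by linarith)
    have := mul_le_mul_of_nonneg_left h6 (by linarith : (0 : ℝ) ≤ p)
    linarith
  -- The total coefficient of W is 1 + (1 + β)(p - 1) = p + βp - β, the 1 coming from f(A) ≤ F + W.
  -- Trading W for (F - F₀) / β puts F₀ on the smaller side of the inequality.
  have h10 : (p + β * p - β) * W ≤ (p / β + p - 1) * (F - F₀) := by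
    have h11 : W ≤ (F - F₀) / β := by rw [le_div_iff₀ hβ]; linarith
    have h12 : 0 ≤ p + β * p - β := by nlinarith
    calc (p + β * p - β) * W ≤ (p + β * p - β) * ((F - F₀) / β) :=
          mul_le_mul_of_nonneg_left h11 h12
      _ = _ := by field_simp
  nlinarith

end PassBound

/-! ### The recursion for γ and β, and the sizes of the parameters -/

section Parameters

/-- In terms of the excess x = γ - 1 - p the recursion reads x ↦ x((3p - 1)x + 4p²) / (x + 2p)²,
which preserves positivity and a bound 4p / (i + 1). -/
theorem gammaSeq_bounds {p : ℕ} (hp : 1 ≤ p) (i : ℕ) :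
    0 < gammaSeq p i - 1 - p ∧ (gammaSeq p i - 1 - p) * (i + 1) ≤ 4 * p := by
  have hp' : (1 : ℝ) ≤ p := by exact_mod_cast hp
  induction i with
  | zero =>
    simp only [gammaSeq]
    constructor
    · linarith
    · push_cast; linarith
  | succ i ih =>
    obtain ⟨h1, h2⟩ := ih
    set x := gammaSeq p i - 1 - p with hx
    have hg : gammaSeq p i = x + 1 + p := by rw [hx]; ring
    have hden : 0 < x + 2 * p := by linarith
    have e : gammaSeq p (i + 1) - 1 - p =
        x * ((3 * p - 1) * x + 4 * p ^ 2) / (x + 2 * p) ^ 2 := by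
      have hd : gammaSeq p i - 1 + p = x + 2 * p := by rw [hg]; ring
      rw [gammaSeq, hd, hg]
      field_simp
      ring
    have h3 : 0 < (3 * p - 1) * x + 4 * (p : ℝ) ^ 2 := by
      have : 0 < (3 * p - 1) * x := mul_pos (by linarith) h1
      positivity
    rw [e]
    refine ⟨by positivity, ?_⟩
    rw [div_mul_eq_mul_div, div_le_iff₀ (by positivity)]
    push_cast
    have hi : (0 : ℝ) ≤ i + 1 := by positivity
    have h4 : x * ((3 * p - 1) * x + 4 * (p : ℝ) ^ 2) * (i + 1) ≤
        4 * p * ((3 * p - 1) * x + 4 * (p : ℝ) ^ 2) := by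
      have := mul_le_mul_of_nonneg_right h2 h3.le
      linarith
    -- The right-hand side is chosen so that, added to that of `h4`, it completes the square 4p(x +
    -- 2p)².
    have h5 : x * ((3 * p - 1) * x + 4 * (p : ℝ) ^ 2) ≤ 4 * p * (x ^ 2 + (p + 1) * x) := by
      nlinarith [mul_pos h1 h1, mul_pos h1 (by linarith : (0 : ℝ) < p)]
    have h6 : x * ((3 * p - 1) * x + 4 * (p : ℝ) ^ 2) * (i + 1 + 1) =
        x * ((3 * p - 1) * x + 4 * (p : ℝ) ^ 2) * (i + 1) +
          x * ((3 * p - 1) * x + 4 * (p : ℝ) ^ 2) := by ring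
    rw [h6]
    refine (add_le_add h4 h5).trans (le_of_eq ?_)
    ring

theorem gammaSeq_pos {p : ℕ} (hp : 1 ≤ p) (i : ℕ) : 0 < gammaSeq p i := by
  have := (gammaSeq_bounds hp i).1
  have hp' : (0 : ℝ) ≤ p := by positivity
  linarith

theorem betaSeq_pos {p : ℕ} (hp : 1 ≤ p) (i : ℕ) : 0 < betaSeq p i := by
  cases i with
  | zero => simp [betaSeq]
  | succ i =>
    have h := (gammaSeq_bounds hp i).1
    have hp' : (0 : ℝ) ≤ p := by positivity
    exact div_pos (by linarith) (by linarith)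

/-- With the previous guarantee γ, a pass with parameter β gives the ratio (2p + βp + p/β)γ / (γ +
p/β + p - 1). The chosen β minimises it, and the minimum is the next γ. -/
theorem betaSeq_succ_identity {p : ℕ} (hp : 1 ≤ p) (i : ℕ) :
    (2 * p + betaSeq p (i + 1) * p + p / betaSeq p (i + 1)) * gammaSeq p i =
      gammaSeq p (i + 1) * (gammaSeq p i + (p / betaSeq p (i + 1) + p - 1)) := by
  have h := (gammaSeq_bounds hp i).1
  have hp' : (1 : ℝ) ≤ p := by exact_mod_cast hp
  have h1 : gammaSeq p i - 1 - p ≠ 0 := h.ne'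
  have h2 : gammaSeq p i - 1 + p ≠ 0 := by intro hc; linarith
  simp only [betaSeq, gammaSeq]
  field_simp
  ring

/-- The recursion behind the parameters: the guarantees improve from pass to pass. -/
theorem le_gammaSeq_mul {p : ℕ} (hp : 1 ≤ p) {Q : ℝ} (a : ℕ → ℝ) (ha : 0 ≤ a 0) (d : ℕ)
    (h : ∀ i < d, Q + (p / betaSeq p i + p - 1) * a i ≤
      (2 * p + betaSeq p i * p + p / betaSeq p i) * a (i + 1)) :
    ∀ i < d, Q ≤ gammaSeq p i * a (i + 1) := by
  have hp' : (1 : ℝ) ≤ p := by exact_mod_cast hp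
  have hc : ∀ i, 0 ≤ (p : ℝ) / betaSeq p i + p - 1 := fun i => by
    have := div_pos (by linarith : (0 : ℝ) < p) (betaSeq_pos hp i)
    linarith
  intro i
  induction i with
  | zero =>
    intro hd
    have h1 := h 0 hd
    have h2 := mul_nonneg (hc 0) ha
    simp only [betaSeq, gammaSeq] at h1 h2 ⊢
    have : (2 * (p : ℝ) + 1 * p + p / 1) * a (0 + 1) = 4 * p * a (0 + 1) := by ring
    linarith
  | succ i ih =>
    intro hd
    have h1 := h (i + 1) hd
    have h2 := ih (by omega)
    have hg := gammaSeq_pos hp i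
    have hid := betaSeq_succ_identity hp i
    have hc' := hc (i + 1)
    set c := (p : ℝ) / betaSeq p (i + 1) + p - 1
    set K := 2 * (p : ℝ) + betaSeq p (i + 1) * p + p / betaSeq p (i + 1)
    -- The pass inequality times γ_i, plus c times the bound of the preceding pass, cancels the old
    -- value a (i + 1).
    have h3 : (gammaSeq p i + c) * Q ≤
        (gammaSeq p i + c) * (gammaSeq p (i + 1) * a (i + 1 + 1)) := by
      calc (gammaSeq p i + c) * Q = gammaSeq p i * Q + c * Q := by ring
        _ ≤ gammaSeq p i * Q + c * (gammaSeq p i * a (i + 1)) := by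
            have := mul_le_mul_of_nonneg_left h2 hc'
            linarith
        _ = gammaSeq p i * (Q + c * a (i + 1)) := by ring
        _ ≤ gammaSeq p i * (K * a (i + 1 + 1)) := mul_le_mul_of_nonneg_left h1 hg.le
        _ = K * gammaSeq p i * a (i + 1 + 1) := by ring
        _ = _ := by rw [hid]; ring
    exact le_of_mul_le_mul_left h3 (by linarith)

theorem accuracy_pos {p : ℕ} (hp : 1 ≤ p) {ε : ℝ} (hε : 0 < ε) : 0 < accuracy p ε := by
  have hp' : (0 : ℝ) < p := by exact_mod_cast hp
  exact lt_min (by positivity) (by norm_num)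

theorem accuracy_le_half (p : ℕ) (ε : ℝ) : accuracy p ε ≤ 1 / 2 := min_le_right _ _

theorem mul_accuracy_le {p : ℕ} (hp : 1 ≤ p) (ε : ℝ) : p * accuracy p ε ≤ ε := by
  have hp' : (0 : ℝ) < p := by exact_mod_cast hp
  have := min_le_left (ε / p) (1 / 2)
  calc p * accuracy p ε ≤ p * (ε / p) := mul_le_mul_of_nonneg_left this hp'.le
    _ = ε := by field_simp

theorem inv_accuracy_le (p : ℕ) (ε : ℝ) : 1 / accuracy p ε ≤ 2 * max 1 (p / ε) := by
  rcases min_choice (ε / p) (1 / 2) with h | h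
  · rw [accuracy, h, one_div_div]
    have h1 := le_max_right 1 (p / ε)
    have h2 := le_max_left 1 (p / ε)
    linarith
  · rw [accuracy, h, one_div_one_div]
    have h2 := le_max_left 1 (p / ε)
    linarith

theorem le_numPasses (ε' : ℝ) : 4 / ε' ≤ numPasses ε' := Nat.le_ceil _

theorem numPasses_pos {ε' : ℝ} (h : 0 < ε') : 0 < numPasses ε' :=
  Nat.ceil_pos.2 (by positivity)

theorem numPasses_le {p : ℕ} (hp : 1 ≤ p) {ε : ℝ} (hε : 0 < ε) :
    (numPasses (accuracy p ε) : ℝ) ≤ 9 * max 1 (p / ε) := by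
  have h0 := accuracy_pos hp hε
  have h1 := Nat.ceil_lt_add_one (a := 4 / accuracy p ε) (by positivity)
  have h2 := inv_accuracy_le p ε
  have h3 : 4 / accuracy p ε = 4 * (1 / accuracy p ε) := by ring
  have h4 := le_max_left 1 (p / ε)
  rw [numPasses]
  linarith

theorem bufferSize_pos {k : ℕ} (hk : 0 < k) {ε' : ℝ} (h : 0 < ε') : 0 < bufferSize k ε' := by
  have hk' : (0 : ℝ) < k := by exact_mod_cast hk
  have hd : (0 : ℝ) < numPasses ε' := by exact_mod_cast numPasses_pos h
  exact Nat.ceil_pos.2 (by positivity)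

/-- The constant is 4 · 9 · 2² + 1, from 9 for the number of passes, 2 for 1 / ε', and 1 for
rounding up. -/
theorem bufferSize_le {k : ℕ} (hk : 0 < k) {p : ℕ} (hp : 1 ≤ p) {ε : ℝ} (hε : 0 < ε) :
    (bufferSize k (accuracy p ε) : ℝ) ≤ 145 * max 1 (p / ε) ^ 3 * k := by
  have h0 := accuracy_pos hp hε
  have hk' : (1 : ℝ) ≤ k := by exact_mod_cast hk
  have h1 := Nat.ceil_lt_add_one
    (a := 4 * (numPasses (accuracy p ε) : ℝ) * k / accuracy p ε ^ 2) (by positivity)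
  have h2 := inv_accuracy_le p ε
  have h3 := numPasses_le hp hε
  have h4 : 4 * (numPasses (accuracy p ε) : ℝ) * k / accuracy p ε ^ 2 =
      4 * numPasses (accuracy p ε) * k * (1 / accuracy p ε) ^ 2 := by ring
  have h5 := le_max_left 1 (p / ε)
  set m := max 1 (p / ε)
  have h6 : 4 * (numPasses (accuracy p ε) : ℝ) * k * (1 / accuracy p ε) ^ 2 ≤
      4 * (9 * m) * k * (2 * m) ^ 2 := by gcongr
  have h7 : 1 ≤ m ^ 3 * k := one_le_mul_of_one_le_of_one_le (one_le_pow₀ h5) hk'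
  rw [bufferSize]
  rw [h4] at h1 ⊢
  refine h1.le.trans ?_
  have h8 : 4 * (9 * m) * k * (2 * m) ^ 2 = 144 * (m ^ 3 * k) := by ring
  have h9 : 145 * m ^ 3 * k = 145 * (m ^ 3 * k) := by ring
  rw [h9]
  linarith

theorem gammaSeq_numPasses_le {p : ℕ} (hp : 1 ≤ p) {ε : ℝ} (hε : 0 < ε) :
    gammaSeq p (numPasses (accuracy p ε) - 1) ≤ p + 1 + p * accuracy p ε := by
  have h0 := accuracy_pos hp hε
  have h1 := (gammaSeq_bounds hp (numPasses (accuracy p ε) - 1))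
  have h2 := numPasses_pos h0
  have h3 : ((numPasses (accuracy p ε) - 1 : ℕ) : ℝ) + 1 = numPasses (accuracy p ε) := by
    rw [Nat.cast_sub h2]; ring
  rw [h3] at h1
  have h4 := le_numPasses (accuracy p ε)
  rw [div_le_iff₀ h0] at h4
  set x := gammaSeq p (numPasses (accuracy p ε) - 1) - 1 - p with hx
  have h5 : 4 * x ≤ 4 * (p * accuracy p ε) := by
    calc 4 * x ≤ (numPasses (accuracy p ε) * accuracy p ε) * x :=
          mul_le_mul_of_nonneg_right h4 h1.1.le
      _ = x * numPasses (accuracy p ε) * accuracy p ε := by ring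
      _ ≤ 4 * p * accuracy p ε := mul_le_mul_of_nonneg_right h1.2 h0.le
      _ = _ := by ring
  linarith

/-- The end points kτ and τ / 2 have ratio 2k, so at most 2 + log₂ k powers of two fit between them.
-/
theorem card_guesses_le {τ : ℝ} {k : ℕ} (hk : 0 < k) :
    ((guesses τ k).card : ℝ) ≤ 2 * (1 + Real.logb 2 k) := by
  have hk' : (1 : ℝ) ≤ k := by exact_mod_cast hk
  have hlog : 0 ≤ Real.logb 2 k := Real.logb_nonneg (by norm_num) hk'
  by_cases hτ : 0 < τ
  · rcases (guesses τ k).eq_empty_or_nonempty with he | he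
    · rw [he]; simp; linarith
    rw [guesses, if_pos hτ] at he ⊢
    rw [Finset.nonempty_Icc] at he
    rw [Int.card_Icc]
    set a := Int.clog 2 (τ / 2)
    set b := Int.log 2 ((k : ℝ) * τ)
    have h1 : τ / 2 ≤ (2 : ℝ) ^ a := by
      exact_mod_cast Int.self_le_zpow_clog (b := 2) (by norm_num) (τ / 2)
    have h2 : (2 : ℝ) ^ b ≤ k * τ := by
      exact_mod_cast Int.zpow_log_le_self (b := 2) (by norm_num) (r := k * τ) (by positivity)
    have h3 : (2 : ℝ) ^ (b - a) ≤ 2 * k := by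
      rw [zpow_sub₀ (by norm_num), div_le_iff₀ (by positivity)]
      calc (2 : ℝ) ^ b ≤ k * τ := h2
        _ = 2 * k * (τ / 2) := by ring
        _ ≤ _ := by gcongr
    have h4 : ((b - a : ℤ) : ℝ) ≤ 1 + Real.logb 2 k := by
      have h5 := Real.logb_le_logb_of_le (b := 2) (by norm_num) (by positivity) h3
      rw [← Real.rpow_intCast, Real.logb_rpow (by norm_num) (by norm_num),
        Real.logb_mul (by norm_num) (by positivity), Real.logb_self_eq_one (by norm_num)] at h5
      exact h5
    have h6 : (((b + 1 - a).toNat : ℤ) : ℝ) = ((b - a : ℤ) : ℝ) + 1 := by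
      rw [Int.toNat_of_nonneg (by omega)]
      push_cast; ring
    have h7 : ((b + 1 - a).toNat : ℝ) = ((b - a : ℤ) : ℝ) + 1 := by exact_mod_cast h6
    rw [h7]
    linarith
  · rw [guesses, if_neg hτ]
    simp
    linarith

/-- A guess of the optimal value within a factor of two. -/
theorem exists_guess {τ V : ℝ} {k : ℕ} (hτ : 0 < τ) (hk : 0 < k) (h1 : τ ≤ V) (h2 : V ≤ k * τ) :
    ∃ i ∈ guesses τ k, V / 2 ≤ (2 : ℝ) ^ i ∧ (2 : ℝ) ^ i ≤ V := by
  have hV : 0 < V := hτ.trans_le h1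
  have h3 : (2 : ℝ) ^ (Int.log 2 V) ≤ V := by
    exact_mod_cast Int.zpow_log_le_self (b := 2) (by norm_num) hV
  have h4 : V < (2 : ℝ) ^ (Int.log 2 V + 1) := by
    exact_mod_cast Int.lt_zpow_succ_log_self (b := 2) (by norm_num) V
  rw [zpow_add₀ (by norm_num), zpow_one] at h4
  exact ⟨Int.log 2 V, (mem_guesses hτ hk _).2 ⟨by linarith, by linarith⟩, by linarith, h3⟩

end Parameters

/-! ### Expectations with values in [0, ∞], free of summability conditions -/

section Expectation

open scoped ENNReal

variable {σ : Type*} {τ : Type*}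

/-- The expected value of a function with values in `[0, ∞]`. -/
noncomputable def mean (μ : PMF σ) (g : σ → ℝ≥0∞) : ℝ≥0∞ :=
  ∑' s, μ s * g s

theorem mean_pure (s : σ) (g : σ → ℝ≥0∞) : mean (PMF.pure s) g = g s := by
  rw [mean, tsum_eq_single s]
  · simp
  · intro t ht
    simp [PMF.pure_apply, ht]

theorem mean_bind (μ : PMF σ) (κ : σ → PMF τ) (g : τ → ℝ≥0∞) :
    mean (μ.bind κ) g = mean μ fun s => mean (κ s) g := by
  simp only [mean, PMF.bind_apply, ← ENNReal.tsum_mul_right, ← ENNReal.tsum_mul_left]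
  rw [ENNReal.tsum_comm]
  simp only [mul_assoc]

theorem mean_map (μ : PMF σ) (h : σ → τ) (g : τ → ℝ≥0∞) :
    mean (μ.map h) g = mean μ fun s => g (h s) := by
  rw [← PMF.bind_pure_comp, mean_bind]
  simp only [Function.comp_apply, mean_pure]

theorem mean_mono {μ : PMF σ} {g h : σ → ℝ≥0∞} (hgh : ∀ s ∈ μ.support, g s ≤ h s) :
    mean μ g ≤ mean μ h := by
  refine ENNReal.tsum_le_tsum fun s => ?_
  by_cases hs : s ∈ μ.support
  · exact mul_le_mul_right (hgh s hs) _
  · rw [PMF.mem_support_iff, not_not] at hs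
    simp [hs]

theorem mean_add (μ : PMF σ) (g h : σ → ℝ≥0∞) :
    mean μ (fun s => g s + h s) = mean μ g + mean μ h := by
  simp only [mean, mul_add, ENNReal.tsum_add]

theorem mean_const_mul (μ : PMF σ) (c : ℝ≥0∞) (g : σ → ℝ≥0∞) :
    mean μ (fun s => c * g s) = c * mean μ g := by
  simp only [mean, ← ENNReal.tsum_mul_left, mul_left_comm]

theorem mean_const (μ : PMF σ) (c : ℝ≥0∞) : mean μ (fun _ => c) = c := by
  rw [mean, ENNReal.tsum_mul_right, PMF.tsum_coe, one_mul]

theorem mean_ne_top {μ : PMF σ} {g : σ → ℝ} {C : ℝ} (h : ∀ s, g s ≤ C) :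
    mean μ (fun s => ENNReal.ofReal (g s)) ≠ ∞ := by
  have : mean μ (fun s => ENNReal.ofReal (g s)) ≤ ENNReal.ofReal C := by
    rw [← mean_const μ (ENNReal.ofReal C)]
    exact mean_mono fun s _ => ENNReal.ofReal_le_ofReal (h s)
  exact (this.trans_lt ENNReal.ofReal_lt_top).ne

theorem mean_uniformOfFinset (s : Finset σ) (hs : s.Nonempty) (g : σ → ℝ) (hg : ∀ y ∈ s, 0 ≤ g y) :
    mean (PMF.uniformOfFinset s hs) (fun y => ENNReal.ofReal (g y)) =
      ENNReal.ofReal ((∑ y ∈ s, g y) / s.card) := by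
  classical
  have hc : (0 : ℝ) < s.card := by exact_mod_cast hs.card_pos
  rw [mean, tsum_eq_sum (s := s)]
  · rw [div_eq_mul_inv, ENNReal.ofReal_mul (Finset.sum_nonneg hg),
      ENNReal.ofReal_sum_of_nonneg hg, ENNReal.ofReal_inv_of_pos hc, Finset.sum_mul]
    refine Finset.sum_congr rfl fun y hy => ?_
    rw [PMF.uniformOfFinset_apply_of_mem hs hy, mul_comm, ENNReal.ofReal_natCast]
  · intro y hy
    rw [PMF.uniformOfFinset_apply_of_notMem hs hy, zero_mul]

theorem ofReal_expect {X : Type*} [Fintype X] (μ : PMF (Finset X)) {f : Finset X → ℝ}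
    (h0 : ∀ S, 0 ≤ f S) :
    ENNReal.ofReal (expect μ f) = mean μ fun S => ENNReal.ofReal (f S) := by
  rw [expect, mean, tsum_fintype,
    ENNReal.ofReal_sum_of_nonneg fun S _ => mul_nonneg ENNReal.toReal_nonneg (h0 S)]
  refine Finset.sum_congr rfl fun S _ => ?_
  rw [ENNReal.ofReal_mul ENNReal.toReal_nonneg, ENNReal.ofReal_toReal (μ.apply_ne_top S)]

theorem expect_nonneg {X : Type*} [Fintype X] (μ : PMF (Finset X)) {f : Finset X → ℝ}
    (h0 : ∀ S, 0 ≤ f S) : 0 ≤ expect μ f :=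
  Finset.sum_nonneg fun S _ => mul_nonneg ENNReal.toReal_nonneg (h0 S)

end Expectation

/-! ### Folds and parallel maps of random transitions -/

section Monadic

variable {σ τ γ : Type u}

theorem foldlM_cons_eq_bind (G : σ → γ → PMF σ) (x : γ) (l : List γ) (s : σ) :
    (x :: l).foldlM G s = (G s x).bind fun t => l.foldlM G t :=
  List.foldlM_cons

theorem foldlM_nil_eq_pure (G : σ → γ → PMF σ) (s : σ) :
    ([] : List γ).foldlM G s = PMF.pure s :=
  List.foldlM_nil

/-- A projection that commutes with each step commutes with the whole fold. It serves both to forget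
the recorded set A and to single out one of the parallel copies. -/
theorem map_foldlM (π : σ → τ) (G : σ → γ → PMF σ) (K : τ → γ → PMF τ)
    (h : ∀ s x, (G s x).map π = K (π s) x) (l : List γ) (s : σ) :
    (l.foldlM G s).map π = l.foldlM K (π s) := by
  induction l generalizing s with
  | nil => rw [foldlM_nil_eq_pure, foldlM_nil_eq_pure, PMF.pure_map]
  | cons x l ih =>
    rw [foldlM_cons_eq_bind, foldlM_cons_eq_bind, PMF.map_bind, ← h, PMF.bind_map]
    congr 1
    funext t
    exact ih t

theorem support_foldlM {G : σ → γ → PMF σ} (I : List γ → σ → Prop)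
    (h : ∀ x l s, I (x :: l) s → ∀ t ∈ (G s x).support, I l t) (l : List γ) (s : σ) (hs : I l s) :
    ∀ t ∈ (l.foldlM G s).support, I [] t := by
  induction l generalizing s with
  | nil =>
    intro t ht
    rw [foldlM_nil_eq_pure, PMF.mem_support_pure_iff] at ht
    exact ht ▸ hs
  | cons x l ih =>
    intro t ht
    rw [foldlM_cons_eq_bind, PMF.mem_support_bind_iff] at ht
    obtain ⟨r, hr, ht⟩ := ht
    exact ih r (h x l s hs r hr) t ht

/-- The submartingale principle: the one-step inequality is needed only in states satisfying the
invariant. -/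
theorem mean_foldlM_ge {G : σ → γ → PMF σ} (I : List γ → σ → Prop) (g : σ → ENNReal)
    (h : ∀ x l s, I (x :: l) s → ∀ t ∈ (G s x).support, I l t)
    (hg : ∀ x l s, I (x :: l) s → g s ≤ mean (G s x) g) (l : List γ) (s : σ) (hs : I l s) :
    g s ≤ mean (l.foldlM G s) g := by
  induction l generalizing s with
  | nil => rw [foldlM_nil_eq_pure, mean_pure]
  | cons x l ih =>
    rw [foldlM_cons_eq_bind, mean_bind]
    exact (hg x l s hs).trans (mean_mono fun t ht => ih t (h x l s hs t ht))

theorem mapM_cons_eq_bind (K : σ → PMF τ) (a : σ) (l : List σ) :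
    (a :: l).mapM K = (K a).bind fun b => (l.mapM K).map fun bs => b :: bs :=
  List.mapM_cons

theorem mapM_nil_eq_pure (K : σ → PMF τ) : ([] : List σ).mapM K = PMF.pure [] :=
  List.mapM_nil

theorem support_mapM (K : σ → PMF τ) (l : List σ) :
    ∀ l' ∈ (l.mapM K).support, List.Forall₂ (fun a b => b ∈ (K a).support) l l' := by
  induction l with
  | nil =>
    intro l' hl'
    rw [mapM_nil_eq_pure, PMF.mem_support_pure_iff] at hl'
    exact hl' ▸ List.Forall₂.nil
  | cons a l ih =>
    intro l' hl'
    rw [mapM_cons_eq_bind, PMF.mem_support_bind_iff] at hl'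
    obtain ⟨b, hb, hl'⟩ := hl'
    rw [PMF.mem_support_map_iff] at hl'
    obtain ⟨bs, hbs, rfl⟩ := hl'
    exact List.Forall₂.cons hb (ih bs hbs)

/-- A random transition, applied to an entry of a list that may be missing. -/
noncomputable def optionKernel (K : σ → PMF τ) : Option σ → PMF (Option τ)
  | none => PMF.pure none
  | some a => (K a).map some

/-- The entries of a list are transformed independently: each marginal law is that of a single
transition. -/
theorem mapM_getElem? (K : σ → PMF τ) (l : List σ) (j : ℕ) :
    (l.mapM K).map (fun l' => l'[j]?) = optionKernel K l[j]? := by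
  induction l generalizing j with
  | nil => rw [mapM_nil_eq_pure, PMF.pure_map]; simp [optionKernel]
  | cons a l ih =>
    rw [mapM_cons_eq_bind, PMF.map_bind]
    cases j with
    | zero =>
      simp only [PMF.map_comp, List.getElem?_cons_zero, Function.comp_def, optionKernel]
      have : ∀ b : τ, (l.mapM K).map (fun _ => some b) = PMF.pure (some b) := fun b =>
        PMF.map_const _ _
      simp only [this]
      exact PMF.bind_pure_comp _ _
    | succ j =>
      simp only [PMF.map_comp, List.getElem?_cons_succ, Function.comp_def, ih, PMF.bind_const]

end Monadic

/-! ### Invariants of one copy -/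

section Copies

variable {ι : Type v} {X : Type u} [DecidableEq X] {p : ℕ}

open scoped Classical in
/-- The first half of an arrival: the new element joins the buffer if it is good. -/
noncomputable def Copy.receive (M : Matchoid ι X p) (f : Finset X → ℝ) (α β : ℝ) (x : X)
    (c : Copy X) : Copy X :=
  tick { c with
    buf := if x ∉ c.start ∧ Good M f α β c.cur x then insert x c.buf else c.buf } 0

open scoped Classical in
/-- The second half of an arrival: the element `y` of the buffer is moved to the solution. -/
noncomputable def Copy.swap (M : Matchoid ι X p) (f : Finset X → ℝ) (α β : ℝ) (c : Copy X)
    (y : X) : Copy X :=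
  let S : List X := (c.cur.filter fun z => z ∉ exchange M f y c.cur) ++ [y]
  tick { c with
    cur := S
    buf := (c.buf.erase y).filter fun z => Good M f α β S z } 0

theorem Copy.arrive_eq (M : Matchoid ι X p) (f : Finset X → ℝ) (α β : ℝ) (m : ℕ) (x : X)
    (c : Copy X) :
    Copy.arrive M f α β m x c =
      if h : (c.receive M f α β x).buf.Nonempty ∧ (c.receive M f α β x).buf.card = m then
        (PMF.uniformOfFinset (c.receive M f α β x).buf h.1).map
          ((c.receive M f α β x).swap M f α β)
      else PMF.pure (c.receive M f α β x) :=
  rfl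

/-- An arrival, recorded together with the set of all elements that have ever been in the
solution. -/
noncomputable def ghostArrive (M : Matchoid ι X p) (f : Finset X → ℝ) (α β : ℝ) (m : ℕ) (x : X)
    (s : Copy X × Finset X) : PMF (Copy X × Finset X) :=
  if h : (s.1.receive M f α β x).buf.Nonempty ∧ (s.1.receive M f α β x).buf.card = m then
    (PMF.uniformOfFinset (s.1.receive M f α β x).buf h.1).map fun y =>
      ((s.1.receive M f α β x).swap M f α β y, insert y s.2)
  else PMF.pure (s.1.receive M f α β x, s.2)

theorem map_fst_ghostArrive (M : Matchoid ι X p) (f : Finset X → ℝ) (α β : ℝ) (m : ℕ) (x : X)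
    (s : Copy X × Finset X) :
    (ghostArrive M f α β m x s).map Prod.fst = Copy.arrive M f α β m x s.1 := by
  rw [Copy.arrive_eq, ghostArrive]
  split_ifs with h
  · rw [PMF.map_comp]
    rfl
  · rw [PMF.pure_map]

variable [Fintype X]

/-- The properties of the memory of a copy between two passes. -/
structure AtRest (M : Matchoid ι X p) (f : Finset X → ℝ) (ε' : ℝ) (c : Copy X) : Prop where
  sol : IsSolution M f c.cur
  guess_nonneg : 0 ≤ c.guess
  best_indep : M.Indep c.best
  peak_le : c.peak ≤ 4 * M.rank + bufferSize M.rank ε'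
  value_ge : f ∅ ≤ f c.cur.toFinset

/-- The properties of the memory of a copy during a pass, when the elements of `l` have yet to
arrive: `A` consists of the elements that have been in the solution during the pass. -/
structure InPass (M : Matchoid ι X p) (f : Finset X → ℝ) (ε' β : ℝ) (l : List X) (c : Copy X)
    (A : Finset X) : Prop where
  history : ∃ w Z, PassHistory M f (threshold M.rank ε' c.guess) β c.start {x | x ∉ l} c.cur c.buf
    A w Z
  guess_nonneg : 0 ≤ c.guess
  start_length : c.start.length ≤ M.rank
  buf_card : c.buf.card ≤ bufferSize M.rank ε'
  best_indep : M.Indep c.best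
  peak_le : c.peak ≤ 4 * M.rank + bufferSize M.rank ε'
  value_ge : f ∅ ≤ f c.cur.toFinset

variable {M : Matchoid ι X p} {f : Finset X → ℝ} {ε' β : ℝ} {l : List X} {c : Copy X}
  {A : Finset X} {x y : X}

theorem threshold_nonneg (k : ℕ) {ε' g : ℝ} (hε : 0 ≤ ε') (hg : 0 ≤ g) : 0 ≤ threshold k ε' g := by
  unfold threshold; positivity

theorem IsSolution.length_le {S : List X} (hS : IsSolution M f S) : S.length ≤ M.rank := by
  rw [← List.toFinset_card_of_nodup hS.nodup]
  exact hS.indep.card_le_rank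

theorem InPass.sol (h : InPass M f ε' β l c A) : IsSolution M f c.cur := by
  obtain ⟨w, Z, h⟩ := h.history
  exact h.sol

/-- The four multiples of the rank are for `start`, `cur`, `best` and the output of the offline
algorithm; the rest is the buffer. -/
theorem peak_tick_le {m e : ℕ} (hs : c.start.length ≤ M.rank) (hc : IsSolution M f c.cur)
    (hb : c.buf.card ≤ m) (hi : M.Indep c.best) (he : e ≤ M.rank)
    (hp : c.peak ≤ 4 * M.rank + m) : (c.tick e).peak ≤ 4 * M.rank + m := by
  have h1 := hc.length_le
  have h2 := hi.card_le_rank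
  simp only [Copy.tick, Copy.size]
  omega

theorem AtRest.startPass (h : AtRest M f ε' c) (β : ℝ) (hl : ∀ x, x ∈ l) :
    InPass M f ε' β l c.startPass c.cur.toFinset where
  history := by
    have : {x | x ∉ l} = ∅ := by ext x; simp [hl x]
    rw [this]
    exact h.sol.passHistory _ _
  guess_nonneg := h.guess_nonneg
  start_length := h.sol.length_le
  buf_card := by simp [Copy.startPass, Copy.tick]
  best_indep := h.best_indep
  peak_le := peak_tick_le (f := f) h.sol.length_le h.sol (by simp) h.best_indep (Nat.zero_le _)
    h.peak_le
  value_ge := h.value_ge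

theorem InPass.receive (hf : Submodular f) (hβ : 0 ≤ β) (hl : (x :: l).Nodup)
    (h : InPass M f ε' β (x :: l) c A) (hc : c.buf.card < bufferSize M.rank ε') :
    InPass M f ε' β l (c.receive M f (threshold M.rank ε' c.guess) β x) A := by
  have hcard : (c.receive M f (threshold M.rank ε' c.guess) β x).buf.card ≤
      bufferSize M.rank ε' := by
    simp only [Copy.receive, Copy.tick]
    split_ifs
    · exact (Finset.card_insert_le _ _).trans hc
    · exact hc.le
  refine ⟨?_, h.guess_nonneg, h.start_length, hcard, h.best_indep, ?_, h.value_ge⟩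
  · obtain ⟨w, Z, hh⟩ := h.history
    refine ⟨w, Z, ?_⟩
    have hP : {z | z ∉ l} = insert x {z | z ∉ x :: l} := by
      ext z
      have := (List.nodup_cons.1 hl).1
      simp only [Set.mem_ofPred_eq, Set.mem_insert_iff, List.mem_cons, not_or]
      by_cases hz : z = x
      · simp [hz, this]
      · simp [hz]
    rw [hP]
    refine hh.arrive hf hβ (by simp) ?_
    simp only [Copy.receive, Copy.tick]
    split_ifs with h1
    · exact Or.inl ⟨h1, rfl⟩
    · exact Or.inr ⟨h1, rfl⟩
  · exact peak_tick_le (f := f) h.start_length h.sol hcard h.best_indep (Nat.zero_le _) h.peak_le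

theorem InPass.add_threshold_le (hf : Submodular f) (hβ : 0 ≤ β) (h : InPass M f ε' β l c A)
    (hy : y ∈ c.buf) :
    f c.cur.toFinset + threshold M.rank ε' c.guess ≤
      f (c.swap M f (threshold M.rank ε' c.guess) β y).cur.toFinset := by
  obtain ⟨w, Z, hh⟩ := h.history
  have hyS : y ∉ c.cur := fun hc => hh.buf_disjoint y hy (hh.subset (List.mem_toFinset.2 hc))
  have h1 := (hh.buf_good y hy).add_le_exchange hf hh.sol.nodup hyS
    (q := fun z => decide (z ∉ exchange M f y c.cur)) (by simp)
  have h2 := mul_nonneg hβ (Finset.sum_nonneg (hh.sol.incr_nonneg_exchange y))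
  refine le_trans ?_ h1
  linarith

theorem InPass.swap_buf_card (h : InPass M f ε' β l c A) (hy : y ∈ c.buf) (α : ℝ) :
    (c.swap M f α β y).buf.card < bufferSize M.rank ε' := by
  classical
  refine lt_of_le_of_lt (Finset.card_filter_le _ _) ?_
  exact (Finset.card_erase_lt_of_mem hy).trans_le h.buf_card

theorem InPass.swap (hf : Submodular f) (hε : 0 ≤ ε') (hβ : 0 ≤ β) (h : InPass M f ε' β l c A)
    (hy : y ∈ c.buf) :
    InPass M f ε' β l (c.swap M f (threshold M.rank ε' c.guess) β y) (insert y A) := by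
  have hα := threshold_nonneg M.rank hε h.guess_nonneg
  have hcard := (h.swap_buf_card hy (threshold M.rank ε' c.guess)).le
  have hval := h.add_threshold_le hf hβ hy
  have hhist : ∃ w Z, PassHistory M f (threshold M.rank ε' c.guess) β c.start {x | x ∉ l}
      (c.swap M f (threshold M.rank ε' c.guess) β y).cur
      (c.swap M f (threshold M.rank ε' c.guess) β y).buf (insert y A) w Z := by
    obtain ⟨w, Z, hh⟩ := h.history
    refine hh.exchange hf hα hβ hy (q := fun z => decide (z ∉ exchange M f y c.cur)) (by simp) ?_
    intro z
    simp only [Copy.swap, Copy.tick, Finset.mem_filter, Finset.mem_erase, and_assoc]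
  refine ⟨hhist, h.guess_nonneg, h.start_length, hcard, h.best_indep, ?_, ?_⟩
  · obtain ⟨w, Z, hh⟩ := hhist
    exact peak_tick_le (f := f) h.start_length hh.sol hcard h.best_indep (Nat.zero_le _) h.peak_le
  · linarith [h.value_ge]

theorem InPass.finishPass (h : InPass M f ε' β l c A) {offline : Finset X → PMF (Finset X)}
    {γ : ℝ} (hoff : IsOfflineApprox M f γ offline) :
    ∀ t ∈ (Copy.finishPass f offline c).support, AtRest M f ε' t := by
  intro t ht
  rw [Copy.finishPass, PMF.mem_support_map_iff] at ht
  obtain ⟨S', hS', rfl⟩ := ht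
  have hi := ((hoff c.buf).1 S' hS').2
  refine ⟨h.sol, h.guess_nonneg, ?_, ?_, h.value_ge⟩
  · dsimp only
    split_ifs
    exacts [hi, h.best_indep]
  · exact peak_tick_le (f := f) h.start_length h.sol h.buf_card h.best_indep hi.card_le_rank
      h.peak_le

theorem atRest_fresh (M : Matchoid ι X p) (f : Finset X → ℝ) (ε' : ℝ) {g : ℝ} (hg : 0 ≤ g) :
    AtRest M f ε' (Copy.fresh g : Copy X) :=
  ⟨isSolution_nil M f, hg, M.indep_empty, Nat.zero_le _, by simp [Copy.fresh]⟩

/-- The invariant of a copy during a pass which began with the solution `S₀`, for the guess `g` and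
the offline solution `b`. -/
def GhostInv (M : Matchoid ι X p) (f : Finset X → ℝ) (ε' β : ℝ) (S₀ : List X) (g : ℝ)
    (b : Finset X) (l : List X) (s : Copy X × Finset X) : Prop :=
  l.Nodup ∧ s.1.buf.card < bufferSize M.rank ε' ∧ s.1.start = S₀ ∧ s.1.guess = g ∧ s.1.best = b ∧
    ∃ A ⊆ s.2, InPass M f ε' β l s.1 A

theorem GhostInv.support (hf : Submodular f) (hε : 0 ≤ ε') (hβ : 0 ≤ β) {S₀ : List X} {g : ℝ}
    {b : Finset X} {s : Copy X × Finset X} (h : GhostInv M f ε' β S₀ g b (x :: l) s) :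
    ∀ t ∈ (ghostArrive M f (threshold M.rank ε' s.1.guess) β (bufferSize M.rank ε') x s).support,
      GhostInv M f ε' β S₀ g b l t := by
  obtain ⟨hl, hcard, h1, h2, h3, A, hA, hp⟩ := h
  have hr := hp.receive hf hβ hl hcard
  intro t ht
  rw [ghostArrive] at ht
  split_ifs at ht with hc
  · rw [PMF.mem_support_map_iff] at ht
    obtain ⟨y, hy, rfl⟩ := ht
    rw [PMF.mem_support_uniformOfFinset_iff] at hy
    exact ⟨(List.nodup_cons.1 hl).2, hr.swap_buf_card hy _, h1, h2, h3, insert y A,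
      Finset.insert_subset_insert _ hA, hr.swap hf hε hβ hy⟩
  · rw [PMF.mem_support_pure_iff] at ht
    subst ht
    refine ⟨(List.nodup_cons.1 hl).2, ?_, h1, h2, h3, A, hA, hr⟩
    -- A buffer of m > 0 elements is nonempty, so a failed test means that it is not full.
    refine lt_of_le_of_ne hr.buf_card fun heq => hc ⟨?_, heq⟩
    exact Finset.card_pos.1 (heq ▸ (Nat.zero_le _).trans_lt hcard)

theorem AtRest.ghostInv (h : AtRest M f ε' c) (β : ℝ) (hl : IsArrivalOrder l)
    (hm : 0 < bufferSize M.rank ε') {A : Finset X} (hA : c.cur.toFinset ⊆ A) :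
    GhostInv M f ε' β c.cur c.guess c.best l (c.startPass, A) :=
  ⟨hl.1, by simpa [Copy.startPass, Copy.tick] using hm, rfl, rfl, rfl, _, hA,
    h.startPass β hl.2⟩

end Copies

/-! ### The offline step at the end of a pass -/

section FinishPass

variable {X : Type u} {f : Finset X → ℝ} {offline : Finset X → PMF (Finset X)}

theorem mean_finishPass (c : Copy X) (φ : Copy X → ENNReal) :
    mean (Copy.finishPass f offline c) φ = mean (offline c.buf) fun S' =>
      φ { c.tick S'.card with best := if f c.best ≤ f S' then S' else c.best } := by
  rw [Copy.finishPass, mean_map]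

theorem mean_finishPass_of_cur (c : Copy X) (φ : List X → ENNReal) :
    mean (Copy.finishPass f offline c) (fun t => φ t.cur) = φ c.cur := by
  rw [mean_finishPass]
  exact mean_const (offline c.buf) (φ c.cur)

theorem best_le_mean_finishPass (c : Copy X) :
    ENNReal.ofReal (f c.best) ≤
      mean (Copy.finishPass f offline c) fun t => ENNReal.ofReal (f t.best) := by
  rw [mean_finishPass, ← mean_const (offline c.buf) (ENNReal.ofReal (f c.best))]
  refine mean_mono fun S' _ => ENNReal.ofReal_le_ofReal ?_
  dsimp only
  split_ifs with h
  exacts [h, le_rfl]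

theorem offline_le_mean_finishPass [Fintype X] (h0 : ∀ S, 0 ≤ f S) (c : Copy X) :
    ENNReal.ofReal (expect (offline c.buf) f) ≤
      mean (Copy.finishPass f offline c) fun t => ENNReal.ofReal (f t.best) := by
  rw [mean_finishPass, ofReal_expect _ h0]
  refine mean_mono fun S' _ => ENNReal.ofReal_le_ofReal ?_
  dsimp only
  split_ifs with h
  exacts [le_rfl, (not_le.1 h).le]

end FinishPass

/-! ### The potential and the expected guarantee of one pass -/

section Analysis

variable {ι : Type v} {X : Type u} [Fintype X] [DecidableEq X] {p : ℕ}
variable {M : Matchoid ι X p} {f : Finset X → ℝ} {ε' β g : ℝ} {l : List X} {O : Finset X}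

/-- The potential of a state of the algorithm. It bounds from below the value of every union of `O`
with elements that have been in the solution, and does not decrease in expectation. -/
noncomputable def potential (f : Finset X → ℝ) (O : Finset X) (a : ℝ) (s : Copy X × Finset X) : ℝ :=
  (1 - (f O - f s.1.cur.toFinset) / a) * lowerHull f O s.2

/-- Let θ be the first factor of the potential and D the hull. An exchange turns θ into at least θ +
1/m, and D into at least (1 - 1/m)D on average. The product does not fall because θ + 1/m ≤ 1. -/
theorem potential_le_mean_arrive (hf : Submodular f) (h0 : ∀ S, 0 ≤ f S) (hε : 0 ≤ ε')
    (hβ : 0 ≤ β) (hO : M.IsOptimal f O) (hα : 0 < threshold M.rank ε' g)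
    (hfew : f O ≤ threshold M.rank ε' g * bufferSize M.rank ε') {S₀ : List X} {b : Finset X}
    {x : X} {s : Copy X × Finset X} (h : GhostInv M f ε' β S₀ g b (x :: l) s) :
    ENNReal.ofReal (potential f O (threshold M.rank ε' g * bufferSize M.rank ε') s) ≤
      mean (ghostArrive M f (threshold M.rank ε' s.1.guess) β (bufferSize M.rank ε') x s)
        fun t => ENNReal.ofReal
          (potential f O (threshold M.rank ε' g * bufferSize M.rank ε') t) := by
  obtain ⟨hl, hcard, h1, h2, h3, A, hA, hp⟩ := h
  have hr := hp.receive hf hβ hl hcard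
  have hm : (0 : ℝ) < bufferSize M.rank ε' := by exact_mod_cast (Nat.zero_le _).trans_lt hcard
  rw [ghostArrive]
  split_ifs with hc
  · rw [mean_map]
    set c := s.1.receive M f (threshold M.rank ε' s.1.guess) β x
    have hcg : c.guess = g := h2
    have hcc : c.cur = s.1.cur := rfl
    set m : ℝ := (bufferSize M.rank ε' : ℝ) with hmdef
    have hmc : (c.buf.card : ℝ) = m := by rw [hc.2]
    have hsum := (hf.lowerHull O).sum_insert_ge (lowerHull_nonneg h0 O) s.2 c.buf
    rw [hmc] at hsum
    have hD := lowerHull_nonneg h0 O s.2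
    set D := lowerHull f O s.2
    set a := threshold M.rank ε' g * m with ha
    have hapos : 0 < a := mul_pos hα hm
    set θ := 1 - (f O - f s.1.cur.toFinset) / a with hθ
    -- This uses `hfew`: at most m exchanges can be paid for, so the factor is non-negative.
    have hθ0 : 0 ≤ θ := by
      have : (f O - f s.1.cur.toFinset) / a ≤ 1 := by
        rw [div_le_one hapos]
        linarith [h0 s.1.cur.toFinset]
      linarith
    have hstep : ∀ y ∈ c.buf, θ + 1 / m ≤
        1 - (f O - f (c.swap M f (threshold M.rank ε' s.1.guess) β y).cur.toFinset) / a := by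
      intro y hy
      have h5 := hr.add_threshold_le hf hβ hy
      rw [hcg, hcc] at h5
      rw [h2]
      have h6 : 1 / m = threshold M.rank ε' g / a := by rw [ha]; field_simp
      rw [hθ, h6, sub_add, ← sub_div, sub_le_sub_iff_left]
      exact div_le_div_of_nonneg_right (by linarith) hapos.le
    -- The solution after an exchange is feasible, hence worth at most f(O).
    have hθ1 : θ + 1 / m ≤ 1 := by
      obtain ⟨y, hy⟩ := hc.1
      refine (hstep y hy).trans ?_
      have h7 := (hr.swap hf hε hβ hy).sol.indep
      have h8 := hO.2 _ h7
      rw [hcg, ← h2] at h8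
      have : 0 ≤ (f O - f (c.swap M f (threshold M.rank ε' s.1.guess) β y).cur.toFinset) / a :=
        div_nonneg (by linarith) hapos.le
      linarith
    have hpot : ∀ y ∈ c.buf, (θ + 1 / m) * lowerHull f O (insert y s.2) ≤
        potential f O a (c.swap M f (threshold M.rank ε' s.1.guess) β y, insert y s.2) :=
      fun y hy => mul_le_mul_of_nonneg_right (hstep y hy) (lowerHull_nonneg h0 O _)
    have hθm : 0 ≤ θ + 1 / m := by positivity
    rw [mean_uniformOfFinset (g := fun y =>
      potential f O a (c.swap M f (threshold M.rank ε' s.1.guess) β y, insert y s.2))]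
    · refine ENNReal.ofReal_le_ofReal ?_
      rw [hmc, le_div_iff₀ hm]
      refine le_trans ?_ (Finset.sum_le_sum hpot)
      rw [← Finset.mul_sum]
      refine le_trans ?_ (mul_le_mul_of_nonneg_left hsum hθm)
      have e1 : (θ + 1 / m) * ((m - 1) * D) - potential f O a s * m =
          (1 - (θ + 1 / m)) * D := by
        have : potential f O a s = θ * D := rfl
        rw [this]
        field_simp
        ring
      have : 0 ≤ (1 - (θ + 1 / m)) * D := mul_nonneg (by linarith) hD
      linarith
    · exact fun y hy => (mul_nonneg hθm (lowerHull_nonneg h0 O _)).trans (hpot y hy)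
  · rw [mean_pure]
    exact le_rfl

/-- One pass of a copy, recorded together with the set of all elements that have ever been in the
solution. -/
noncomputable def ghostPass (M : Matchoid ι X p) (f : Finset X → ℝ)
    (offline : Finset X → PMF (Finset X)) (ε' β : ℝ) (stream : List X) (s : Copy X × Finset X) :
    PMF (Copy X × Finset X) :=
  (stream.foldlM (fun s x =>
    ghostArrive M f (threshold M.rank ε' s.1.guess) β (bufferSize M.rank ε') x s)
    (s.1.startPass, s.2)).bind fun t =>
      (Copy.finishPass f offline t.1).map fun c => (c, t.2)

/-- The invariant between two passes. -/
def RestInv (M : Matchoid ι X p) (f : Finset X → ℝ) (ε' g : ℝ) (s : Copy X × Finset X) : Prop :=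
  AtRest M f ε' s.1 ∧ s.1.guess = g ∧ s.1.cur.toFinset ⊆ s.2

variable {offline : Finset X → PMF (Finset X)} {γ : ℝ} {s : Copy X × Finset X}

theorem RestInv.support_fold (hf : Submodular f) (hε : 0 ≤ ε') (hβ : 0 ≤ β)
    (hl : IsArrivalOrder l) (hm : 0 < bufferSize M.rank ε') (h : RestInv M f ε' g s) :
    ∀ t ∈ (l.foldlM (fun s x =>
      ghostArrive M f (threshold M.rank ε' s.1.guess) β (bufferSize M.rank ε') x s)
      (s.1.startPass, s.2)).support, GhostInv M f ε' β s.1.cur g s.1.best [] t :=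
  support_foldlM (GhostInv M f ε' β s.1.cur g s.1.best)
    (fun _ _ _ h' => h'.support hf hε hβ) l _ (h.2.1 ▸ h.1.ghostInv β hl hm h.2.2)

theorem RestInv.support_ghostPass (hf : Submodular f) (hε : 0 ≤ ε') (hβ : 0 ≤ β)
    (hl : IsArrivalOrder l) (hm : 0 < bufferSize M.rank ε') (hoff : IsOfflineApprox M f γ offline)
    (h : RestInv M f ε' g s) :
    ∀ t ∈ (ghostPass M f offline ε' β l s).support, RestInv M f ε' g t := by
  intro t ht
  rw [ghostPass, PMF.mem_support_bind_iff] at ht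
  obtain ⟨r, hr, ht⟩ := ht
  obtain ⟨-, -, h1, h2, h3, A, hA, hp⟩ := h.support_fold hf hε hβ hl hm r hr
  rw [PMF.mem_support_map_iff] at ht
  obtain ⟨c, hc, rfl⟩ := ht
  refine ⟨hp.finishPass hoff c hc, ?_, ?_⟩ <;>
    rw [Copy.finishPass, PMF.mem_support_map_iff] at hc <;> obtain ⟨S', -, rfl⟩ := hc
  · exact h2
  · obtain ⟨w, Z, hh⟩ := hp.history
    exact hh.subset.trans hA

theorem mean_ghostPass (stream : List X) (s : Copy X × Finset X)
    (φ : Copy X × Finset X → ENNReal) :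
    mean (ghostPass M f offline ε' β stream s) φ =
      mean (stream.foldlM (fun s x =>
        ghostArrive M f (threshold M.rank ε' s.1.guess) β (bufferSize M.rank ε') x s)
        (s.1.startPass, s.2)) fun t =>
          mean (Copy.finishPass f offline t.1) fun c => φ (c, t.2) := by
  rw [ghostPass, mean_bind]
  simp only [mean_map]

theorem potential_le_mean_ghostPass (hf : Submodular f) (h0 : ∀ S, 0 ≤ f S) (hε : 0 ≤ ε')
    (hβ : 0 ≤ β) (hl : IsArrivalOrder l) (hm : 0 < bufferSize M.rank ε') (hO : M.IsOptimal f O)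
    (hα : 0 < threshold M.rank ε' g)
    (hfew : f O ≤ threshold M.rank ε' g * bufferSize M.rank ε') (h : RestInv M f ε' g s) :
    ENNReal.ofReal (potential f O (threshold M.rank ε' g * bufferSize M.rank ε') s) ≤
      mean (ghostPass M f offline ε' β l s)
        fun t => ENNReal.ofReal
          (potential f O (threshold M.rank ε' g * bufferSize M.rank ε') t) := by
  rw [mean_ghostPass]
  have key := mean_foldlM_ge (G := fun s x =>
      ghostArrive M f (threshold M.rank ε' s.1.guess) β (bufferSize M.rank ε') x s)
    (GhostInv M f ε' β s.1.cur g s.1.best)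
    (fun t => ENNReal.ofReal
      (potential f O (threshold M.rank ε' g * bufferSize M.rank ε') t))
    (fun _ _ _ h' => h'.support hf hε hβ)
    (fun _ _ _ h' => potential_le_mean_arrive hf h0 hε hβ hO hα hfew h')
    l (s.1.startPass, s.2) (h.2.1 ▸ h.1.ghostInv β hl hm h.2.2)
  refine le_trans key (mean_mono fun t _ => le_of_eq ?_)
  exact (mean_finishPass_of_cur t.1 fun S => ENNReal.ofReal
    ((1 - (f O - f S.toFinset) / (threshold M.rank ε' g * bufferSize M.rank ε')) *
      lowerHull f O t.2)).symm

theorem best_le_mean_ghostPass (hf : Submodular f) (hε : 0 ≤ ε') (hβ : 0 ≤ β)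
    (hl : IsArrivalOrder l) (hm : 0 < bufferSize M.rank ε') (h : RestInv M f ε' g s) :
    ENNReal.ofReal (f s.1.best) ≤
      mean (ghostPass M f offline ε' β l s) fun t => ENNReal.ofReal (f t.1.best) := by
  rw [mean_ghostPass]
  refine le_trans (mean_const _ _).ge (mean_mono fun t ht => ?_)
  have hb := (h.support_fold hf hε hβ hl hm t ht).2.2.2.2.1
  rw [← hb]
  exact best_le_mean_finishPass t.1

/-- The expected guarantee of one pass. -/
theorem mean_ghostPass_bound (hf : Submodular f) (h0 : ∀ S, 0 ≤ f S) (hp : 1 ≤ p) (hε : 0 ≤ ε')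
    (hβ : 0 < β) (hγ : 0 ≤ γ) (hl : IsArrivalOrder l) (hm : 0 < bufferSize M.rank ε')
    (hoff : IsOfflineApprox M f γ offline) (hO : M.Indep O) (h : RestInv M f ε' g s) :
    mean (ghostPass M f offline ε' β l s) (fun t => ENNReal.ofReal (lowerHull f O t.2)) +
        ENNReal.ofReal (p / β + p - 1) * ENNReal.ofReal (f s.1.cur.toFinset) ≤
      ENNReal.ofReal (M.rank * threshold M.rank ε' g) +
        ENNReal.ofReal (2 * p + β * p + p / β) *
          mean (ghostPass M f offline ε' β l s)
            (fun t => ENNReal.ofReal (f t.1.cur.toFinset)) +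
        ENNReal.ofReal γ *
          mean (ghostPass M f offline ε' β l s) (fun t => ENNReal.ofReal (f t.1.best)) := by
  have hp' : (1 : ℝ) ≤ p := by exact_mod_cast hp
  have hα : 0 ≤ threshold M.rank ε' g := threshold_nonneg M.rank hε (h.2.1 ▸ h.1.guess_nonneg)
  have hpβ : 0 < (p : ℝ) / β := div_pos (by linarith) hβ
  have hc : 0 ≤ (p : ℝ) / β + p - 1 := by linarith
  have hK : 0 ≤ 2 * p + β * p + p / β := by positivity
  simp only [mean_ghostPass]
  set μ := l.foldlM (fun s x =>
    ghostArrive M f (threshold M.rank ε' s.1.guess) β (bufferSize M.rank ε') x s)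
    (s.1.startPass, s.2) with hμ
  rw [← mean_const μ (ENNReal.ofReal (p / β + p - 1) * _), ← mean_add,
    ← mean_const μ (ENNReal.ofReal (M.rank * threshold M.rank ε' g)), ← mean_const_mul,
    ← mean_const_mul, ← mean_add, ← mean_add]
  refine mean_mono fun t ht => ?_
  obtain ⟨-, -, h1, h2, h3, A, hA, hpass⟩ := h.support_fold hf hε hβ.le hl hm t ht
  obtain ⟨w, Z, hh⟩ := hpass.history
  rw [h1, h2] at hh
  have hmain := hh.optimal_le hf h0 hp hα hβ (by simp) hO
  -- The pass guarantee concerns the A of this pass, a subset of the set recorded over all passes.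
  have hlow := lowerHull_le f O hA
  have hofl := (hoff t.1.buf).2 (O ∩ t.1.buf) Finset.inter_subset_right
    (hO.mono Finset.inter_subset_left)
  rw [mean_const, mean_finishPass_of_cur t.1 fun S => ENNReal.ofReal (f S.toFinset)]
  have he := expect_nonneg (offline t.1.buf) h0
  calc ENNReal.ofReal (lowerHull f O t.2) +
        ENNReal.ofReal (p / β + p - 1) * ENNReal.ofReal (f s.1.cur.toFinset)
      = ENNReal.ofReal (lowerHull f O t.2 + (p / β + p - 1) * f s.1.cur.toFinset) := by
        rw [ENNReal.ofReal_add (lowerHull_nonneg h0 O _) (mul_nonneg hc (h0 _)),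
          ENNReal.ofReal_mul hc]
    _ ≤ ENNReal.ofReal (M.rank * threshold M.rank ε' g +
          (2 * p + β * p + p / β) * f t.1.cur.toFinset + γ * expect (offline t.1.buf) f) :=
        ENNReal.ofReal_le_ofReal (by linarith)
    _ = ENNReal.ofReal (M.rank * threshold M.rank ε' g) +
          ENNReal.ofReal (2 * p + β * p + p / β) * ENNReal.ofReal (f t.1.cur.toFinset) +
          ENNReal.ofReal γ * ENNReal.ofReal (expect (offline t.1.buf) f) := by
        have e1 : 0 ≤ M.rank * threshold M.rank ε' g := by positivity
        have e2 := mul_nonneg hK (h0 t.1.cur.toFinset)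
        rw [ENNReal.ofReal_add (by linarith) (mul_nonneg hγ he), ENNReal.ofReal_add e1 e2,
          ENNReal.ofReal_mul hK, ENNReal.ofReal_mul hγ]
    _ ≤ _ := by
        gcongr
        exact offline_le_mean_finishPass h0 t.1

end Analysis

/-! ### Comparing the output with the copies -/

section Result

variable {ι : Type v} {X : Type u} [DecidableEq X] {p : ℕ}
  {M : Matchoid ι X p} {f : Finset X → ℝ}

theorem cur_le_result (f : Finset X → ℝ) (c : Copy X) :
    f c.cur.toFinset ≤ f (Copy.result f c) := by
  unfold Copy.result
  split_ifs with h
  exacts [h, le_rfl]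

theorem best_le_result (f : Finset X → ℝ) (c : Copy X) : f c.best ≤ f (Copy.result f c) := by
  unfold Copy.result
  split_ifs with h
  exacts [le_rfl, (not_le.1 h).le]

theorem result_le_output (f : Finset X → ℝ) {R : Run X} {c : Copy X} (hc : c ∈ R.copies) :
    f (Copy.result f c) ≤ f (R.output f) := by
  have hmem : Copy.result f c ∈ R.copies.map (Copy.result f) := List.mem_map_of_mem hc
  unfold Run.output
  rcases h : (R.copies.map (Copy.result f)).argmax f with _ | S
  · rw [List.argmax_eq_none.1 h] at hmem
    simp at hmem
  · exact List.le_of_mem_argmax hmem h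

theorem output_eq (f : Finset X → ℝ) (R : Run X) :
    R.output f = ∅ ∨ ∃ c ∈ R.copies, R.output f = Copy.result f c := by
  unfold Run.output
  rcases h : (R.copies.map (Copy.result f)).argmax f with _ | S
  · exact Or.inl rfl
  · obtain ⟨c, hc, rfl⟩ := List.mem_map.1 (List.argmax_mem h)
    exact Or.inr ⟨c, hc, rfl⟩

variable [Fintype X] {ε' : ℝ}

theorem AtRest.indep_result {c : Copy X} (h : AtRest M f ε' c) : M.Indep (Copy.result f c) := by
  unfold Copy.result
  split_ifs
  exacts [h.best_indep, h.sol.indep]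

theorem indep_output {R : Run X} (h : ∀ c ∈ R.copies, AtRest M f ε' c) :
    M.Indep (R.output f) := by
  rcases output_eq f R with h1 | ⟨c, hc, h1⟩
  · rw [h1]
    exact M.indep_empty
  · rw [h1]
    exact (h c hc).indep_result

theorem empty_le_output {R : Run X} (h : ∀ c ∈ R.copies, AtRest M f ε' c) :
    f ∅ ≤ f (R.output f) := by
  rcases output_eq f R with h1 | ⟨c, hc, h1⟩
  · rw [h1]
  · rw [h1]
    exact (h c hc).value_ge.trans (cur_le_result f c)

end Result

/-! ### From the parallel run to a single copy -/

section Runs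

variable {ι : Type v} {X : Type u} [Fintype X] [DecidableEq X] {p : ℕ}
  {M : Matchoid ι X p} {f : Finset X → ℝ} {ε' β γ : ℝ} {offline : Finset X → PMF (Finset X)}

theorem exists_of_mem_of_support_mapM {σ τ : Type u} {K : σ → PMF τ} {l : List σ} {l' : List τ}
    (h : l' ∈ (l.mapM K).support) {b : τ} (hb : b ∈ l') : ∃ a ∈ l, b ∈ (K a).support := by
  have h2 := support_mapM K l l' h
  clear h
  induction h2 with
  | nil => simp at hb
  | cons h1 _ ih =>
    rcases List.mem_cons.1 hb with rfl | hb
    · exact ⟨_, List.mem_cons_self, h1⟩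
    · obtain ⟨a, ha, h3⟩ := ih hb
      exact ⟨a, List.mem_cons_of_mem _ ha, h3⟩

theorem length_of_support_mapM {σ τ : Type u} {K : σ → PMF τ} {l : List σ} {l' : List τ}
    (h : l' ∈ (l.mapM K).support) : l'.length = l.length :=
  (support_mapM K l l' h).length_eq.symm

theorem passes_of_support (stream : List X) {R R' : Run X}
    (h : R' ∈ (localSearchPass M f offline ε' β stream R).support) :
    R'.copies.length = R.copies.length ∧ R'.passes = R.passes + 1 := by
  rw [localSearchPass, PMF.mem_support_bind_iff] at h
  obtain ⟨cs, hcs, h⟩ := h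
  rw [PMF.mem_support_map_iff] at h
  obtain ⟨cs', hcs', rfl⟩ := h
  refine ⟨?_, rfl⟩
  have h1 := support_foldlM (fun (_ : List X) (cs : List (Copy X)) =>
    cs.length = R.copies.length)
    (fun x l cs h t ht => (length_of_support_mapM ht).trans h) stream _ (by simp) cs hcs
  exact (length_of_support_mapM hcs').trans h1

theorem atRest_of_support (hf : Submodular f) (hε : 0 ≤ ε') (hβ : 0 ≤ β) {stream : List X}
    (hl : IsArrivalOrder stream) (hm : 0 < bufferSize M.rank ε')
    (hoff : IsOfflineApprox M f γ offline) {R R' : Run X} (hR : ∀ c ∈ R.copies, AtRest M f ε' c)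
    (h : R' ∈ (localSearchPass M f offline ε' β stream R).support) :
    ∀ c ∈ R'.copies, AtRest M f ε' c := by
  rw [localSearchPass, PMF.mem_support_bind_iff] at h
  obtain ⟨cs, hcs, h⟩ := h
  rw [PMF.mem_support_map_iff] at h
  obtain ⟨cs', hcs', rfl⟩ := h
  -- The run does not record A, so the invariant asserts its existence separately for each copy.
  have h1 := support_foldlM (fun (l : List X) (cs : List (Copy X)) =>
      ∀ c ∈ cs, ∃ S₀ g b A, GhostInv M f ε' β S₀ g b l (c, A))
    (fun x l cs h t ht c hc => by
      obtain ⟨c', hc', h2⟩ := exists_of_mem_of_support_mapM ht hc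
      obtain ⟨S₀, g, b, A, h3⟩ := h c' hc'
      rw [← map_fst_ghostArrive M f _ β _ x (c', A), PMF.mem_support_map_iff] at h2
      obtain ⟨s, hs, rfl⟩ := h2
      exact ⟨S₀, g, b, s.2, h3.support hf hε hβ s hs⟩) stream _
    (fun c hc => by
      obtain ⟨c', hc', rfl⟩ := List.mem_map.1 hc
      exact ⟨_, _, _, _, (hR c' hc').ghostInv β hl hm subset_rfl⟩) cs hcs
  intro c hc
  obtain ⟨c', hc', h2⟩ := exists_of_mem_of_support_mapM hcs' hc
  obtain ⟨S₀, g, b, A, -, -, -, -, -, A', -, h3⟩ := h1 c' hc'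
  exact h3.finishPass hoff c h2

theorem length_of_support_runPasses (stream : ℕ → List X) (i : ℕ) :
    ∀ R ∈ (runPasses M f offline ε' stream i).support,
      R.copies.length = (guesses (maxSingleton M f (stream 0)) M.rank).card ∧
        R.passes = i + 1 := by
  induction i with
  | zero =>
    intro R hR
    rw [runPasses, PMF.mem_support_pure_iff] at hR
    subst hR
    simp [firstPass]
  | succ i ih =>
    intro R' hR'
    rw [runPasses, PMF.mem_support_bind_iff] at hR'
    obtain ⟨R, hR, hR'⟩ := hR'
    obtain ⟨h1, h2⟩ := passes_of_support _ hR'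
    obtain ⟨h3, h4⟩ := ih R hR
    exact ⟨h1.trans h3, by omega⟩

theorem atRest_of_support_runPasses (hp : 1 ≤ p) (hf : Submodular f) (hε : 0 ≤ ε')
    {stream : ℕ → List X} (hl : ∀ j, IsArrivalOrder (stream j))
    (hm : 0 < bufferSize M.rank ε') (hoff : IsOfflineApprox M f γ offline) (i : ℕ) :
    ∀ R ∈ (runPasses M f offline ε' stream i).support, ∀ c ∈ R.copies, AtRest M f ε' c := by
  induction i with
  | zero =>
    intro R hR c hc
    rw [runPasses, PMF.mem_support_pure_iff] at hR
    subst hR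
    obtain ⟨j, -, rfl⟩ := List.mem_map.1 hc
    exact atRest_fresh M f ε' (by positivity)
  | succ i ih =>
    intro R' hR'
    rw [runPasses, PMF.mem_support_bind_iff] at hR'
    obtain ⟨R, hR, hR'⟩ := hR'
    exact atRest_of_support hf hε (betaSeq_pos hp i).le (hl _) hm hoff (ih R hR) hR'

/-- The law of a single copy after `i` passes, recorded together with the set of all elements that
have ever been in the solution. -/
noncomputable def ghostRun (M : Matchoid ι X p) (f : Finset X → ℝ)
    (offline : Finset X → PMF (Finset X)) (ε' g : ℝ) (stream : ℕ → List X) :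
    ℕ → PMF (Copy X × Finset X)
  | 0 => PMF.pure (Copy.fresh g, ∅)
  | i + 1 => (ghostRun M f offline ε' g stream i).bind
      (ghostPass M f offline ε' (betaSeq p i) (stream (i + 1)))

theorem map_localSearchPass (stream : List X) (R : Run X) (j : ℕ) :
    (localSearchPass M f offline ε' β stream R).map (fun R => R.copies[j]?) =
      (stream.foldlM (fun o x => optionKernel (fun c =>
        Copy.arrive M f (threshold M.rank ε' c.guess) β (bufferSize M.rank ε') x c) o)
        (R.copies[j]?.map Copy.startPass)).bind (optionKernel (Copy.finishPass f offline)) := by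
  rw [localSearchPass, PMF.map_bind, ← List.getElem?_map,
    ← map_foldlM (fun cs : List (Copy X) => cs[j]?) _ _ (fun cs x => mapM_getElem? _ cs j),
    PMF.bind_map]
  congr 1
  funext cs
  rw [PMF.map_comp]
  exact mapM_getElem? _ cs j

theorem map_ghostPass (stream : List X) (s : Copy X × Finset X) :
    (ghostPass M f offline ε' β stream s).map (fun s => some s.1) =
      (stream.foldlM (fun o x => optionKernel (fun c =>
        Copy.arrive M f (threshold M.rank ε' c.guess) β (bufferSize M.rank ε') x c) o)
        (some s.1.startPass)).bind (optionKernel (Copy.finishPass f offline)) := by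
  rw [ghostPass, PMF.map_bind]
  have h := map_foldlM (fun s : Copy X × Finset X => some s.1)
    (fun s x => ghostArrive M f (threshold M.rank ε' s.1.guess) β (bufferSize M.rank ε') x s)
    (fun o x => optionKernel (fun c =>
        Copy.arrive M f (threshold M.rank ε' c.guess) β (bufferSize M.rank ε') x c) o)
    (fun s x => by
      simp only [optionKernel]
      rw [← map_fst_ghostArrive, PMF.map_comp]
      rfl) stream (s.1.startPass, s.2)
  dsimp only at h
  rw [← h, PMF.bind_map]
  congr 1
  funext t
  rw [PMF.map_comp]
  rfl

/-- Both laws project to the same chain on `Option (Copy X)`. Only this marginal law is needed; the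
joint law of the copies plays no role. -/
theorem map_runPasses (stream : ℕ → List X) {j : ℕ} {e : ℤ}
    (hj : (guesses (maxSingleton M f (stream 0)) M.rank).toList[j]? = some e) (i : ℕ) :
    (runPasses M f offline ε' stream i).map (fun R => R.copies[j]?) =
      (ghostRun M f offline ε' ((2 : ℝ) ^ e) stream i).map fun s => some s.1 := by
  induction i with
  | zero =>
    rw [runPasses, ghostRun, PMF.pure_map, PMF.pure_map]
    simp [firstPass, hj]
  | succ i ih =>
    rw [runPasses, ghostRun, PMF.map_bind, PMF.map_bind]
    simp only [map_localSearchPass, map_ghostPass]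
    have h1 := congrArg (fun μ => PMF.bind μ fun o : Option (Copy X) =>
      ((stream (i + 1)).foldlM (fun o x => optionKernel (fun c =>
        Copy.arrive M f (threshold M.rank ε' c.guess) (betaSeq p i) (bufferSize M.rank ε') x c) o)
        (o.map Copy.startPass)).bind (optionKernel (Copy.finishPass f offline))) ih
    simp only [PMF.bind_map, Function.comp_def] at h1
    exact h1

theorem mean_result_le_expect_output (h0 : ∀ S, 0 ≤ f S) (stream : ℕ → List X) {e : ℤ}
    (he : e ∈ guesses (maxSingleton M f (stream 0)) M.rank) (i : ℕ) :
    mean (ghostRun M f offline ε' ((2 : ℝ) ^ e) stream i)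
        (fun s => ENNReal.ofReal (f (Copy.result f s.1))) ≤
      ENNReal.ofReal (expect ((runPasses M f offline ε' stream i).map (Run.output f)) f) := by
  obtain ⟨j, hj⟩ := List.mem_iff_getElem?.1 (Finset.mem_toList.2 he)
  let h : Option (Copy X) → ENNReal := fun o =>
    o.elim 0 fun c => ENNReal.ofReal (f (Copy.result f c))
  have h1 : mean (ghostRun M f offline ε' ((2 : ℝ) ^ e) stream i)
      (fun s => ENNReal.ofReal (f (Copy.result f s.1))) =
      mean (runPasses M f offline ε' stream i) fun R => h R.copies[j]? := by
    rw [← mean_map _ (fun R : Run X => R.copies[j]?) h, map_runPasses stream hj i, mean_map]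
    rfl
  rw [h1, ofReal_expect _ h0, mean_map]
  refine mean_mono fun R _ => ?_
  rcases hR : R.copies[j]? with _ | c
  · exact zero_le
  · exact ENNReal.ofReal_le_ofReal (result_le_output f (List.mem_of_getElem? hR))

theorem restInv_of_support_ghostRun (hp : 1 ≤ p) (hf : Submodular f) (hε : 0 ≤ ε')
    {stream : ℕ → List X} (hl : ∀ j, IsArrivalOrder (stream j))
    (hm : 0 < bufferSize M.rank ε') (hoff : IsOfflineApprox M f γ offline) {g : ℝ} (hg : 0 ≤ g)
    (i : ℕ) : ∀ s ∈ (ghostRun M f offline ε' g stream i).support, RestInv M f ε' g s := by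
  induction i with
  | zero =>
    intro s hs
    rw [ghostRun, PMF.mem_support_pure_iff] at hs
    subst hs
    exact ⟨atRest_fresh M f ε' hg, rfl, by simp [Copy.fresh]⟩
  | succ i ih =>
    intro t ht
    rw [ghostRun, PMF.mem_support_bind_iff] at ht
    obtain ⟨s, hs, ht⟩ := ht
    exact (ih s hs).support_ghostPass hf hε (betaSeq_pos hp i).le (hl _) hm hoff t ht

/-- The expected guarantee of a copy whose guess of the optimal value makes few exchanges
possible. -/
theorem sub_le_mul_result (hp : 1 ≤ p) (hf : Submodular f) (h0 : ∀ S, 0 ≤ f S) (hε : 0 ≤ ε')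
    (hγ : 0 ≤ γ) {stream : ℕ → List X} (hl : ∀ j, IsArrivalOrder (stream j))
    (hm : 0 < bufferSize M.rank ε') (hoff : IsOfflineApprox M f γ offline) {g : ℝ} (hg : 0 ≤ g)
    {O : Finset X} (hO : M.IsOptimal f O) (hα : 0 < threshold M.rank ε' g)
    (hfew : f O ≤ threshold M.rank ε' g * bufferSize M.rank ε') {d : ℕ} (hd : 0 < d) {r : ℝ}
    (hr0 : 0 ≤ r) (hr : mean (ghostRun M f offline ε' g stream d)
      (fun s => ENNReal.ofReal (f (Copy.result f s.1))) ≤ ENNReal.ofReal r) :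
    (1 - f O / (threshold M.rank ε' g * bufferSize M.rank ε')) * f O -
      M.rank * threshold M.rank ε' g ≤ (gammaSeq p (d - 1) + γ) * r := by
  have hp' : (1 : ℝ) ≤ p := by exact_mod_cast hp
  set α := threshold M.rank ε' g with hαdef
  set m : ℝ := (bufferSize M.rank ε' : ℝ) with hmdef
  have hm' : 0 < m := Nat.cast_pos.2 hm
  set μ := ghostRun M f offline ε' g stream with hμ
  have hrest := restInv_of_support_ghostRun (stream := stream) hp hf hε hl hm hoff hg
  obtain ⟨C, hC⟩ : ∃ C, ∀ S, f S ≤ C := by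
    obtain ⟨S, hS⟩ := Finite.exists_max f
    exact ⟨f S, hS⟩
  let a : ℕ → ENNReal := fun i => mean (μ i) fun s => ENNReal.ofReal (f s.1.cur.toFinset)
  let b : ℕ → ENNReal := fun i => mean (μ i) fun s => ENNReal.ofReal (f s.1.best)
  let G : ℕ → ENNReal := fun i => mean (μ i) fun s => ENNReal.ofReal (lowerHull f O s.2)
  let Φ : ℕ → ENNReal := fun i => mean (μ i) fun s => ENNReal.ofReal (potential f O (α * m) s)
  have ha : ∀ i, a i ≠ ⊤ := fun i => mean_ne_top fun s => hC _
  have hb : ∀ i, b i ≠ ⊤ := fun i => mean_ne_top fun s => hC _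
  have hG : ∀ i, G i ≠ ⊤ := fun i => mean_ne_top (C := f O) fun s =>
    (lowerHull_le f O (Finset.empty_subset _)).trans (by rw [Finset.union_empty])
  have hbmono : Monotone b := monotone_nat_of_le_succ fun i => by
    change _ ≤ mean (μ (i + 1)) _
    rw [hμ, ghostRun, mean_bind]
    exact mean_mono fun s hs =>
      best_le_mean_ghostPass hf hε (betaSeq_pos hp i).le (hl _) hm (hrest i s hs)
  have hΦmono : Monotone Φ := monotone_nat_of_le_succ fun i => by
    change _ ≤ mean (μ (i + 1)) _
    rw [hμ, ghostRun, mean_bind]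
    exact mean_mono fun s hs => potential_le_mean_ghostPass hf h0 hε (betaSeq_pos hp i).le (hl _)
      hm hO hα hfew (hrest i s hs)
  have hΦG : ∀ i, Φ i ≤ G i := fun i => mean_mono fun s hs => by
    refine ENNReal.ofReal_le_ofReal ?_
    refine mul_le_of_le_one_left (lowerHull_nonneg h0 O _) ?_
    have h1 := hO.2 _ (hrest i s hs).1.sol.indep
    have : 0 ≤ (f O - f s.1.cur.toFinset) / (α * m) :=
      div_nonneg (by linarith) (mul_pos hα hm').le
    linarith
  -- A lower bound for the initial potential, hence for the expected hull after every pass.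
  set q := (1 - f O / (α * m)) * f O with hq
  have hqΦ : ENNReal.ofReal q ≤ Φ 0 := by
    change _ ≤ mean (μ 0) _
    rw [hμ, ghostRun, mean_pure]
    refine ENNReal.ofReal_le_ofReal ?_
    have h1 : potential f O (α * m) (Copy.fresh g, ∅) = (1 - (f O - f ∅) / (α * m)) * f O := by
      simp [potential, Copy.fresh, lowerHull_empty]
    rw [h1, hq]
    refine mul_le_mul_of_nonneg_right ?_ (h0 O)
    have := div_le_div_of_nonneg_right (by linarith [h0 ∅] : f O - f ∅ ≤ f O)
      (mul_pos hα hm').le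
    linarith
  have hqG : ∀ i, q ≤ (G i).toReal := fun i =>
    (ENNReal.ofReal_le_iff_le_toReal (hG i)).1 (hqΦ.trans ((hΦmono (Nat.zero_le i)).trans (hΦG i)))
  -- The best offline value is replaced by its expectation after the last pass, which is the
  -- largest, so the term Q of the recursion does not depend on i.
  have hstep : ∀ i < d, (q - M.rank * α - γ * (b d).toReal) +
      (p / betaSeq p i + p - 1) * (a i).toReal ≤
      (2 * p + betaSeq p i * p + p / betaSeq p i) * (a (i + 1)).toReal := by
    intro i hi
    have hβ := betaSeq_pos hp i
    have hpβ : 0 < (p : ℝ) / betaSeq p i := div_pos (by linarith) hβ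
    have hc : 0 ≤ (p : ℝ) / betaSeq p i + p - 1 := by linarith
    have hK : 0 ≤ 2 * p + betaSeq p i * p + p / betaSeq p i := by positivity
    have key : G (i + 1) + ENNReal.ofReal (p / betaSeq p i + p - 1) * a i ≤
        ENNReal.ofReal (M.rank * α) +
          ENNReal.ofReal (2 * p + betaSeq p i * p + p / betaSeq p i) * a (i + 1) +
          ENNReal.ofReal γ * b (i + 1) := by
      simp only [G, a, b, hμ, ghostRun, mean_bind]
      rw [← mean_const_mul, ← mean_add, ← mean_const_mul, ← mean_const_mul,
        ← mean_const (ghostRun M f offline ε' g stream i) (ENNReal.ofReal (M.rank * α)),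
        ← mean_add, ← mean_add]
      exact mean_mono fun s hs => mean_ghostPass_bound hf h0 hp hε hβ hγ (hl _) hm hoff hO.1
        (hrest i s hs)
    have fin : ∀ x : ℝ, ∀ y : ENNReal, y ≠ ⊤ → ENNReal.ofReal x * y ≠ ⊤ := fun x y hy =>
      ENNReal.mul_ne_top ENNReal.ofReal_ne_top hy
    have key2 := ENNReal.toReal_mono (ENNReal.add_ne_top.2 ⟨ENNReal.add_ne_top.2
      ⟨ENNReal.ofReal_ne_top, fin _ _ (ha _)⟩, fin _ _ (hb _)⟩) key
    rw [ENNReal.toReal_add (hG _) (fin _ _ (ha _)), ENNReal.toReal_add (ENNReal.add_ne_top.2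
      ⟨ENNReal.ofReal_ne_top, fin _ _ (ha _)⟩) (fin _ _ (hb _)),
      ENNReal.toReal_add ENNReal.ofReal_ne_top (fin _ _ (ha _)), ENNReal.toReal_mul,
      ENNReal.toReal_mul, ENNReal.toReal_mul, ENNReal.toReal_ofReal hc, ENNReal.toReal_ofReal hK,
      ENNReal.toReal_ofReal hγ, ENNReal.toReal_ofReal (by positivity)] at key2
    have h1 := hqG (i + 1)
    have h2 := mul_le_mul_of_nonneg_left (ENNReal.toReal_mono (hb d) (hbmono hi)) hγ
    linarith
  have hfin := le_gammaSeq_mul hp (fun i => (a i).toReal) ENNReal.toReal_nonneg d hstep (d - 1)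
    (by omega)
  rw [Nat.sub_add_cancel hd] at hfin
  have har : (a d).toReal ≤ r := by
    refine ENNReal.toReal_le_of_le_ofReal hr0 (le_trans (mean_mono fun s _ => ?_) hr)
    exact ENNReal.ofReal_le_ofReal (cur_le_result f s.1)
  have hbr : (b d).toReal ≤ r := by
    refine ENNReal.toReal_le_of_le_ofReal hr0 (le_trans (mean_mono fun s _ => ?_) hr)
    exact ENNReal.ofReal_le_ofReal (best_le_result f s.1)
  have h3 := mul_le_mul_of_nonneg_left har (gammaSeq_pos hp (d - 1)).le
  have h4 := mul_le_mul_of_nonneg_left hbr hγ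
  linarith

end Runs

/-! ### The largest singleton and the range of the optimal value -/

section Singletons

variable {ι : Type v} {X : Type u} {p : ℕ} {M : Matchoid ι X p} {f : Finset X → ℝ}

open scoped Classical in
theorem foldl_maxSingleton (M : Matchoid ι X p) (f : Finset X → ℝ) (l : List X) (t : ℝ) :
    t ≤ l.foldl (fun t x => if M.Indep {x} then max t (f {x}) else t) t ∧
      (∀ x ∈ l, M.Indep {x} →
        f {x} ≤ l.foldl (fun t x => if M.Indep {x} then max t (f {x}) else t) t) ∧
      (l.foldl (fun t x => if M.Indep {x} then max t (f {x}) else t) t = t ∨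
        ∃ x, M.Indep {x} ∧
          l.foldl (fun t x => if M.Indep {x} then max t (f {x}) else t) t = f {x}) := by
  induction l generalizing t with
  | nil => simp
  | cons y l ih =>
    obtain ⟨h1, h2, h3⟩ := ih (if M.Indep {y} then max t (f {y}) else t)
    rw [List.foldl_cons]
    refine ⟨le_trans ?_ h1, fun x hx hi => ?_, ?_⟩
    · split_ifs
      exacts [le_max_left _ _, le_rfl]
    · rcases List.mem_cons.1 hx with rfl | hx
      · refine le_trans ?_ h1
        rw [if_pos hi]
        exact le_max_right _ _
      · exact h2 x hx hi
    · rcases h3 with h3 | h3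
      · rw [h3]
        split_ifs with hi
        · rcases max_choice t (f {y}) with h4 | h4
          · exact Or.inl h4
          · exact Or.inr ⟨y, hi, h4⟩
        · exact Or.inl rfl
      · exact Or.inr h3

theorem le_maxSingleton {l : List X} (hl : IsArrivalOrder l) {x : X} (hx : M.Indep {x}) :
    f {x} ≤ maxSingleton M f l :=
  (foldl_maxSingleton M f l 0).2.1 x (hl.2 x) hx

theorem exists_eq_maxSingleton (l : List X) (h : 0 < maxSingleton M f l) :
    ∃ x, M.Indep {x} ∧ maxSingleton M f l = f {x} := by
  rcases (foldl_maxSingleton M f l 0).2.2 with h1 | h1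
  · exact absurd h1 h.ne'
  · exact h1

theorem maxSingleton_le_optimal (l : List X) (h : 0 < maxSingleton M f l) {O : Finset X}
    (hO : M.IsOptimal f O) : maxSingleton M f l ≤ f O := by
  obtain ⟨x, hx, h1⟩ := exists_eq_maxSingleton l h
  rw [h1]
  exact hO.2 _ hx

variable [Fintype X]

theorem rank_pos_of_maxSingleton_pos (l : List X) (h : 0 < maxSingleton M f l) : 0 < M.rank := by
  obtain ⟨x, hx, -⟩ := exists_eq_maxSingleton l h
  have := hx.card_le_rank
  rw [Finset.card_singleton] at this
  exact this

variable [DecidableEq X]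

/-- Submodularity gives f(O) ≤ f(∅) + |O|(τ - f(∅)). The strict inequality makes O nonempty, so the
terms with f(∅) sum to at most zero. -/
theorem optimal_le_rank_mul (hf : Submodular f) (h0 : ∀ S, 0 ≤ f S) {l : List X}
    (hl : IsArrivalOrder l) {O : Finset X} (hO : M.Indep O) (hlt : f ∅ < f O) :
    f O ≤ M.rank * maxSingleton M f l := by
  have hne : O.Nonempty := by
    rw [Finset.nonempty_iff_ne_empty]
    rintro rfl
    exact lt_irrefl _ hlt
  have hcard : (1 : ℝ) ≤ O.card := by exact_mod_cast hne.card_pos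
  have hrank : (O.card : ℝ) ≤ M.rank := by exact_mod_cast hO.card_le_rank
  have h1 := hf.union_le_sum_marginal ∅ O (Finset.disjoint_empty_right O)
  rw [Finset.empty_union] at h1
  have h2 : ∑ x ∈ O, marginal f x ∅ ≤ ∑ _x ∈ O, (maxSingleton M f l - f ∅) :=
    Finset.sum_le_sum fun x hx => by
      rw [marginal, insert_empty_eq]
      have := le_maxSingleton (f := f) hl (hO.mono (Finset.singleton_subset_iff.2 hx))
      linarith
  rw [Finset.sum_const, nsmul_eq_mul] at h2
  have h3 : 0 ≤ maxSingleton M f l := (foldl_maxSingleton M f l 0).1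
  have h4 := mul_le_mul_of_nonneg_right hrank h3
  nlinarith [h0 ∅]

theorem guesses_eq_empty {τ : ℝ} (h : ¬ 0 < τ) (k : ℕ) : guesses τ k = ∅ := if_neg h

end Singletons

/-! ### Space, passes and approximation ratio -/

section Guarantee

variable {ι : Type v} {X : Type u} [Fintype X] [DecidableEq X] {p : ℕ}
  {M : Matchoid ι X p} {f : Finset X → ℝ} {ε γ : ℝ} {offline : Finset X → PMF (Finset X)}
  {stream : ℕ → List X}

theorem atRest_of_support_multipass (hp : 1 ≤ p) (hf : Submodular f)
    (hoff : IsOfflineApprox M f γ offline) (hl : ∀ j, IsArrivalOrder (stream j)) (hε : 0 < ε)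
    {R : Run X} (hR : R ∈ (multipassRandomizedLocalSearch M f offline ε stream).support) :
    ∀ c ∈ R.copies, AtRest M f (accuracy p ε) c := by
  by_cases hτ : 0 < maxSingleton M f (stream 0)
  · exact atRest_of_support_runPasses hp hf (accuracy_pos hp hε).le hl
      (bufferSize_pos (rank_pos_of_maxSingleton_pos _ hτ) (accuracy_pos hp hε)) hoff _ R hR
  · intro c hc
    have h := (length_of_support_runPasses stream _ R hR).1
    rw [guesses_eq_empty hτ, Finset.card_empty] at h
    rw [List.length_eq_zero_iff.1 h] at hc
    simp at hc

theorem passes_le (hp : 1 ≤ p) (hε : 0 < ε)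
    {R : Run X} (hR : R ∈ (multipassRandomizedLocalSearch M f offline ε stream).support) :
    (R.passes : ℝ) ≤ 10 * max 1 (p / ε) := by
  rw [(length_of_support_runPasses stream _ R hR).2]
  have h1 := numPasses_le hp hε
  have h2 := le_max_left 1 (p / ε)
  push_cast
  linarith

theorem space_le (hp : 1 ≤ p) (hf : Submodular f)
    (hoff : IsOfflineApprox M f γ offline) (hl : ∀ j, IsArrivalOrder (stream j)) (hε : 0 < ε)
    {R : Run X} (hR : R ∈ (multipassRandomizedLocalSearch M f offline ε stream).support) :
    (R.space : ℝ) ≤ 298 * max 1 (p / ε) ^ 3 * M.rank * (1 + Real.logb 2 M.rank) := by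
  have hlen := (length_of_support_runPasses stream _ R hR).1
  by_cases hτ : 0 < maxSingleton M f (stream 0)
  · have hk := rank_pos_of_maxSingleton_pos _ hτ
    have hk' : (1 : ℝ) ≤ M.rank := by exact_mod_cast hk
    have hrest := atRest_of_support_multipass hp hf hoff hl hε hR
    have h1 : R.space ≤ R.copies.length * (4 * M.rank + bufferSize M.rank (accuracy p ε)) := by
      unfold Run.space
      refine (List.sum_le_card_nsmul _ (4 * M.rank + bufferSize M.rank (accuracy p ε)) ?_).trans
        (by simp)
      intro n hn
      obtain ⟨c, hc, rfl⟩ := List.mem_map.1 hn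
      exact (hrest c hc).peak_le
    have h2 : (R.space : ℝ) ≤
        R.copies.length * (4 * M.rank + bufferSize M.rank (accuracy p ε)) := by exact_mod_cast h1
    have h3 := card_guesses_le (τ := maxSingleton M f (stream 0)) hk
    rw [← hlen] at h3
    have h4 := bufferSize_le hk hp hε
    have h5 := one_le_pow₀ (le_max_left 1 (p / ε)) (n := 3)
    -- Here 149 = 4 + 145; the at most 2(1 + log₂ k) copies turn this into 298.
    have h6 : 4 * (M.rank : ℝ) + bufferSize M.rank (accuracy p ε) ≤
        149 * max 1 (p / ε) ^ 3 * M.rank := by nlinarith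
    have hlog : 0 ≤ Real.logb 2 M.rank := Real.logb_nonneg (by norm_num) hk'
    calc (R.space : ℝ) ≤ R.copies.length * (4 * M.rank + bufferSize M.rank (accuracy p ε)) := h2
      _ ≤ (2 * (1 + Real.logb 2 M.rank)) * (149 * max 1 (p / ε) ^ 3 * M.rank) := by gcongr
      _ = _ := by ring
  · rw [guesses_eq_empty hτ, Finset.card_empty] at hlen
    have h1 : R.space = 0 := by
      rw [Run.space, List.length_eq_zero_iff.1 hlen]
      rfl
    rw [h1, Nat.cast_zero]
    rcases Nat.eq_zero_or_pos M.rank with hk | hk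
    · rw [hk]; simp
    · have hlog : 0 ≤ Real.logb 2 M.rank :=
        Real.logb_nonneg (by norm_num) (by exact_mod_cast hk)
      positivity

theorem empty_le_expect (hp : 1 ≤ p) (hf : Submodular f) (h0 : ∀ S, 0 ≤ f S)
    (hoff : IsOfflineApprox M f γ offline) (hl : ∀ j, IsArrivalOrder (stream j)) (hε : 0 < ε) :
    f ∅ ≤ expect ((multipassRandomizedLocalSearch M f offline ε stream).map (Run.output f)) f := by
  rw [← ENNReal.ofReal_le_ofReal_iff (expect_nonneg _ h0), ofReal_expect _ h0, mean_map]
  refine le_trans (mean_const _ _).ge (mean_mono fun R hR => ENNReal.ofReal_le_ofReal ?_)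
  exact empty_le_output (atRest_of_support_multipass hp hf hoff hl hε hR)

/-- The guess within a factor of two of the optimal value yields the approximation guarantee. -/
theorem mul_optimal_le (hp : 1 ≤ p) (hf : Submodular f) (h0 : ∀ S, 0 ≤ f S) (hγ : 0 ≤ γ)
    (hoff : IsOfflineApprox M f γ offline) (hl : ∀ j, IsArrivalOrder (stream j)) (hε : 0 < ε)
    {O : Finset X} (hO : M.IsOptimal f O) (hlt : f ∅ < f O) :
    (1 - accuracy p ε) * f O ≤ (p + 1 + p * accuracy p ε + γ) *
      expect ((multipassRandomizedLocalSearch M f offline ε stream).map (Run.output f)) f := by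
  have hV : 0 < f O := (h0 ∅).trans_lt hlt
  have hupper := optimal_le_rank_mul hf h0 (hl 0) hO.1 hlt
  have hτ : 0 < maxSingleton M f (stream 0) := by
    by_contra hc
    have := mul_nonpos_of_nonneg_of_nonpos (Nat.cast_nonneg (α := ℝ) M.rank) (not_lt.1 hc)
    linarith
  have hk := rank_pos_of_maxSingleton_pos _ hτ
  have hk' : (0 : ℝ) < M.rank := by exact_mod_cast hk
  have hacc := accuracy_pos hp hε
  obtain ⟨e, he, hge, hgV⟩ :=
    exists_guess hτ hk (maxSingleton_le_optimal _ hτ hO) hupper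
  have hm := bufferSize_pos hk hacc
  have hd := numPasses_pos hacc
  have hd4 := le_numPasses (accuracy p ε)
  have hgam := gammaSeq_numPasses_le hp hε
  have hhalf := accuracy_le_half p ε
  have hr0 := expect_nonneg
    ((multipassRandomizedLocalSearch M f offline ε stream).map (Run.output f)) h0
  have hr := mean_result_le_expect_output (ε' := accuracy p ε) (offline := offline) h0 stream he
    (numPasses (accuracy p ε))
  rw [← multipassRandomizedLocalSearch] at hr
  set g : ℝ := 2 ^ e
  have hg : 0 < g := by positivity
  set ε' := accuracy p ε
  set d := numPasses ε'
  have hd' : (0 : ℝ) < d := by exact_mod_cast hd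
  have hbuf : 4 * (d : ℝ) * M.rank / ε' ^ 2 ≤ bufferSize M.rank ε' := Nat.le_ceil _
  have hα : 0 < threshold M.rank ε' g := by unfold threshold; positivity
  have hkα : M.rank * threshold M.rank ε' g = ε' * g / 2 := by
    unfold threshold; field_simp
  have hprod : 2 * d * g / ε' ≤ threshold M.rank ε' g * bufferSize M.rank ε' := by
    calc 2 * d * g / ε' = threshold M.rank ε' g * (4 * (d : ℝ) * M.rank / ε' ^ 2) := by
          unfold threshold; field_simp; ring
      _ ≤ _ := mul_le_mul_of_nonneg_left hbuf hα.le
  have hd8 : 8 ≤ (d : ℝ) := by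
    refine le_trans ?_ hd4
    rw [le_div_iff₀ hacc]
    linarith
  -- From αm ≥ 2dg / ε', with d ≥ 8 and g ≥ f(O) / 2.
  have hlarge : 8 / ε' * f O ≤ threshold M.rank ε' g * bufferSize M.rank ε' := by
    refine le_trans ?_ hprod
    rw [div_mul_eq_mul_div]
    refine div_le_div_of_nonneg_right ?_ hacc.le
    nlinarith
  have h8 : 2 / ε' * f O ≤ threshold M.rank ε' g * bufferSize M.rank ε' := by
    refine le_trans (mul_le_mul_of_nonneg_right ?_ hV.le) hlarge
    exact div_le_div_of_nonneg_right (by norm_num) hacc.le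
  have hfew : f O ≤ threshold M.rank ε' g * bufferSize M.rank ε' := by
    refine le_trans (le_mul_of_one_le_left hV.le ?_) h8
    rw [le_div_iff₀ hacc]
    linarith
  have hmain := sub_le_mul_result hp hf h0 hacc.le hγ hl hm hoff hg.le hO hα hfew hd hr0 hr
  have hfrac : f O / (threshold M.rank ε' g * bufferSize M.rank ε') ≤ ε' / 2 := by
    rw [div_le_iff₀ (hV.trans_le hfew)]
    calc f O = ε' / 2 * (2 / ε' * f O) := by field_simp
      _ ≤ _ := mul_le_mul_of_nonneg_left h8 (by positivity)
  rw [hkα] at hmain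
  -- The loss ε' f(O) has two halves: kα for the threshold, and f(O)² / (αm) for non-monotonicity.
  have h1 : ε' * g / 2 ≤ ε' / 2 * f O := by
    have := mul_le_mul_of_nonneg_left hgV hacc.le
    linarith
  have h2 := mul_le_mul_of_nonneg_right hfrac hV.le
  have h3 := mul_le_mul_of_nonneg_right (add_le_add_left hgam γ) hr0
  linarith

end Guarantee

end MultipassStreaming

theorem mainTheorem3 :
    ∃ C : ℝ, 0 < C ∧
      ∀ (X : Type u) [Fintype X] [DecidableEq X] (ι : Type v) (p : ℕ) (M : Matchoid ι X p)
        (f : Finset X → ℝ) (γ : ℝ) (offline : Finset X → PMF (Finset X))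
        (stream : ℕ → List X) (ε : ℝ),
        1 ≤ p → (∀ S, 0 ≤ f S) → Submodular f →
        1 ≤ γ → IsOfflineApprox M f γ offline →
        (∀ j, IsArrivalOrder (stream j)) → 0 < ε →
        (∀ R ∈ (multipassRandomizedLocalSearch M f offline ε stream).support,
          M.Indep (R.output f) ∧
          (R.passes : ℝ) ≤ C * max 1 (p / ε) ∧
          (R.space : ℝ) ≤ C * max 1 (p / ε) ^ 3 * M.rank * (1 + Real.logb 2 M.rank)) ∧
        ∀ OPT, M.IsOptimal f OPT →
          f OPT ≤ (p + 1 + γ + C * (1 + γ / p) * ε) *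
            expect ((multipassRandomizedLocalSearch M f offline ε stream).map
              (Run.output f)) f := by
  refine ⟨298, by norm_num, ?_⟩
  intro X _ _ ι p M f γ offline stream ε hp h0 hf hγ hoff hl hε
  refine ⟨fun R hR => ⟨indep_output (atRest_of_support_multipass hp hf hoff hl hε hR), ?_,
    space_le hp hf hoff hl hε hR⟩, fun O hO => ?_⟩
  · have h1 := passes_le hp hε hR
    have h2 := le_max_left 1 (p / ε)
    linarith
  · have hp' : (1 : ℝ) ≤ p := by exact_mod_cast hp
    have hr0 := expect_nonneg
      ((multipassRandomizedLocalSearch M f offline ε stream).map (Run.output f)) h0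
    by_cases hlt : f ∅ < f O
    · have hmain := mul_optimal_le hp hf h0 (by linarith) hoff hl hε hO hlt
      have hacc := accuracy_pos hp hε
      have hhalf := accuracy_le_half p ε
      have hpacc := mul_accuracy_le hp ε
      set r := expect ((multipassRandomizedLocalSearch M f offline ε stream).map
        (Run.output f)) f
      set ε' := accuracy p ε
      have hV := h0 O
      -- For ε' ≤ 1/2 the factor 1 + 2ε' dominates 1 / (1 - ε').
      have h1 : f O ≤ (1 + 2 * ε') * ((p + 1 + p * ε' + γ) * r) := by
        have h2 := mul_le_mul_of_nonneg_left hmain (by linarith : 0 ≤ 1 + 2 * ε')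
        have h3 : 1 ≤ (1 + 2 * ε') * (1 - ε') := by nlinarith
        have h4 := mul_le_mul_of_nonneg_right h3 hV
        linarith
      refine h1.trans ?_
      rw [← mul_assoc]
      refine mul_le_mul_of_nonneg_right ?_ hr0
      have hq : 0 ≤ γ / p := by positivity
      have e1 : γ = γ / p * p := by field_simp
      set c := γ / p
      have h5 : (p * ε') * (1 + c) ≤ (1 + c) * ε := by
        rw [mul_comm]
        exact mul_le_mul_of_nonneg_left hpacc (by linarith)
      have h6 : 0 ≤ (1 + c) * ε := by positivity
      -- The terms beyond p + 1 + γ are 3pε' + 2ε' + 2pε'² + 2ε'γ. The first three are at most 6pε',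
      -- since p ≥ 1 and ε' ≤ 1/2, and ε'γ = pε' · γ/p.
      have h7 : (1 + 2 * ε') * (p + 1 + p * ε' + γ) ≤ p + 1 + γ + 6 * ((p * ε') * (1 + c)) := by
        have h8 : ε' * (p * ε') ≤ 1 / 2 * (p * ε') :=
          mul_le_mul_of_nonneg_right hhalf (by positivity)
        have h9 : ε' ≤ p * ε' := le_mul_of_one_le_left hacc.le hp'
        have h10 : (p * ε') * c = ε' * γ := by
          rw [e1]; ring
        have h11 : 0 ≤ ε' * γ := by positivity
        nlinarith
      linarith
    · have h1 := empty_le_expect hp hf h0 hoff hl hε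
      refine ((not_lt.1 hlt).trans h1).trans (le_mul_of_one_le_left hr0 ?_)
      have : 0 ≤ 298 * (1 + γ / p) * ε := by positivity
      linarith
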